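/- Let $(M^2,g)$ be a connected, oriented smooth Riemannian surface with Levi-Civita connection $\nabla$ and Gaussian curvature $K$, and let $c\in\mathbb{R}$ be a constant such that $(\nabla K)(p)\neq 0$ and $c-K(p)>0$ at every point $p\in M$. Let $X_1=(\nabla K)/|\nabla K|$ and let $X_2$ be the smooth vector field on $M$ such that $\{X_1(p),X_2(p)\}$ is a positively oriented orthonormal basis of $T_pM$ for every $p$. Suppose that the level curves of $K$ are circles of curvature $$\kappa=\frac{3X_1K}{8(c-K)}=\frac{3|\nabla K|}{8(c-K)},$$ in the following sense: for every level curve $\gamma$ of $K$ that is parametrized by arc length and directed so that $\{X_1,\gamma'\}$ is positively oriented, $\kappa$ is constant along $\gamma$ and is the signed geodesic curvature of $\gamma$, i.e. $\nabla_{\gamma'}\gamma'=\kappa N$, where $N$ is the unit normal for which $\{\gamma',N\}$ is positively oriented. Then for every point $p_0\in M$ there are $\varepsilon>0$ and a positively oriented smooth parametrization $X=X(u,s)$, $(u,s)\in(-\varepsilon,\varepsilon)^2$, of an open neighbourhood $U$ of $p_0$ (a diffeomorphism onto $U$), with $g_{11}=g(X_u,X_u)$, $g_{12}=g(X_u,X_s)$,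 $g_{22}=g(X_s,X_s)$, such that (a) the curve $u\mapsto X(u,0)$ is an integral curve of $X_1$ with $X(0,0)=p_0$, and for every $u$ the curve $s\mapsto X(u,s)$ is an integral curve of $X_2$; (b) $K(X(u,s))=K(X(u,0))=:K(u)$ for all $(u,s)$, and $K(u)$ is smooth; (c) for all $(u,s)$, $$g_{11}(u,s)=\frac{9}{64}\left(\frac{K'(u)}{c-K(u)}\right)^2s^2+1,\qquad g_{12}(u,s)=-\frac{3K'(u)}{8(c-K(u))}\,s,\qquad g_{22}(u,s)=1;$$ (d) $K=K(u)$ satisfies $24(c-K)K''+33(K')^2+64K(c-K)^2=0$; (e) $X_1=X_u-g_{12}X_s$ and $X_2=X_s$ on $U$. Moreover, on all of $M$, $$\nabla_{X_1}X_1=\nabla_{X_1}X_2=0,\qquad \nabla_{X_2}X_2=-\frac{3X_1K}{8(c-K)}X_1,\qquad \nabla_{X_2}X_1=\frac{3X_1K}{8(c-K)}X_2,$$ and the integral curves of $X_1$ are geodesics. -/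

import Mathlib

set_option linter.unusedSectionVars false

open Bundle Manifold
open scoped ContDiff Topology

noncomputable section

namespace RiemSurface

section
variable {E : Type*} [NormedAddCommGroup E] [NormedSpace ℝ E] [FiniteDimensional ℝ E]
  {H : Type*} [TopologicalSpace H] {I : ModelWithCorners ℝ E H}
  {M : Type*} [TopologicalSpace M] [ChartedSpace H M]
  [RiemannianBundle (fun x : M ↦ TangentSpace I x)]

instance tangent_finiteDimensional (x : M) : FiniteDimensional ℝ (TangentSpace I x) :=
  inferInstanceAs (FiniteDimensional ℝ E)

instance tangent_completeSpace (x : M) : CompleteSpace (TangentSpace I x) :=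
  FiniteDimensional.complete ℝ _

/-- The gradient of a function: the vector representing the differential through the metric. -/
def mgradient (f : M → ℝ) (x : M) : TangentSpace I x :=
  (InnerProductSpace.toDual ℝ (TangentSpace I x)).symm (mvfderiv I f x)

/-- The right-hand side of the Koszul formula
`2⟨∇_X Y, Z⟩ = X⟨Y, Z⟩ + Y⟨X, Z⟩ - Z⟨X, Y⟩ + ⟨[X, Y], Z⟩ - ⟨[X, Z], Y⟩ - ⟨[Y, Z], X⟩`. -/
def koszul (X Y Z : Π x : M, TangentSpace I x) (x : M) : ℝ :=
  mvfderiv I (fun y ↦ inner ℝ (Y y) (Z y)) x (X x)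
    + mvfderiv I (fun y ↦ inner ℝ (X y) (Z y)) x (Y x)
    - mvfderiv I (fun y ↦ inner ℝ (X y) (Y y)) x (Z x)
    + inner ℝ (VectorField.mlieBracket I X Y x) (Z x)
    - inner ℝ (VectorField.mlieBracket I X Z x) (Y x)
    - inner ℝ (VectorField.mlieBracket I Y Z x) (X x)

variable [IsManifold I ∞ M] [IsContMDiffRiemannianBundle I ∞ E (fun x : M ↦ TangentSpace I x)]

theorem mdiffAt_inner {x : M} {X Y : Π x : M, TangentSpace I x}
    (hX : MDiffAt (T% X) x) (hY : MDiffAt (T% Y) x) :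
    MDiffAt (fun y ↦ (inner ℝ (X y) (Y y) : ℝ)) x :=
  MDifferentiableAt.inner_bundle (E := fun x : M ↦ TangentSpace I x) hX hY

theorem koszul_tensorial₁ {x : M} {Y Z : Π x : M, TangentSpace I x}
    (hY : MDiffAt (T% Y) x) (hZ : MDiffAt (T% Z) x) :
    TensorialAt I E (fun X ↦ koszul X Y Z x) x where
  smul {f X} hf hX := by
    have h1 := mvfderiv_fun_mul hf (mdiffAt_inner hX hY)
    have h2 := mvfderiv_fun_mul hf (mdiffAt_inner hX hZ)
    simp [koszul, VectorField.mlieBracket_smul_left hf hX, inner_smul_left, inner_smul_right, inner_add_left, h1, h2]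
    simp [real_inner_comm]
    ring
  add hX hX' := by
    have h1 := mvfderiv_fun_add (mdiffAt_inner hX hY) (mdiffAt_inner hX' hY)
    have h2 := mvfderiv_fun_add (mdiffAt_inner hX hZ) (mdiffAt_inner hX' hZ)
    simp [koszul, VectorField.mlieBracket_add_left hX hX', inner_add_left, inner_add_right, h1, h2]
    ring

theorem koszul_tensorial₃ {x : M} {X Y : Π x : M, TangentSpace I x}
    (hX : MDiffAt (T% X) x) (hY : MDiffAt (T% Y) x) :
    TensorialAt I E (fun Z ↦ koszul X Y Z x) x where
  smul {f Z} hf hZ := by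
    have h1 := mvfderiv_fun_mul hf (mdiffAt_inner hX hZ)
    have h2 := mvfderiv_fun_mul hf (mdiffAt_inner hY hZ)
    simp [koszul, VectorField.mlieBracket_smul_right hf hZ, inner_smul_left, inner_smul_right,
      inner_add_left, h1, h2]
    simp [real_inner_comm]
    ring
  add hZ hZ' := by
    have h1 := mvfderiv_fun_add (mdiffAt_inner hX hZ) (mdiffAt_inner hX hZ')
    have h2 := mvfderiv_fun_add (mdiffAt_inner hY hZ) (mdiffAt_inner hY hZ')
    simp [koszul, VectorField.mlieBracket_add_right hZ hZ', inner_add_left, inner_add_right, h1, h2]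
    ring

/-- The Koszul expression at `x`, as a bilinear form in the values of `X` and `Z` at `x`. -/
def koszulHom {Y : Π x : M, TangentSpace I x} {x : M} (hY : MDiffAt (T% Y) x) :
    TangentSpace I x →L[ℝ] TangentSpace I x →L[ℝ] ℝ :=
  TensorialAt.mkHom₂ (I := I) (F := E) (F' := E) (fun X Z ↦ koszul X Y Z x) x
    (fun _ hZ ↦ koszul_tensorial₁ hY hZ) (fun _ hX ↦ koszul_tensorial₃ hX hY)

/-- The endomorphism of the tangent space that represents a bilinear form. -/
def rieszHom {x : M} (B : TangentSpace I x →L[ℝ] TangentSpace I x →L[ℝ] ℝ) :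
    TangentSpace I x →L[ℝ] TangentSpace I x :=
  LinearMap.toContinuousLinearMap
    { toFun := fun v ↦ (InnerProductSpace.toDual ℝ (TangentSpace I x)).symm (B v)
      map_add' := fun v w ↦ by simp
      map_smul' := fun c v ↦ by simp }

open Classical in
/-- The Levi-Civita derivative of `Y` at `x`, read off the Koszul formula; it is put equal to zero at
points where `Y` is not differentiable. -/
def leviCivitaFun (Y : Π x : M, TangentSpace I x) (x : M) :
    TangentSpace I x →L[ℝ] TangentSpace I x :=
  if hY : MDiffAt (T% Y) x then rieszHom ((1 / 2 : ℝ) • koszulHom hY) else 0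

theorem inner_leviCivitaFun {x : M} {X Y Z : Π x : M, TangentSpace I x}
    (hX : MDiffAt (T% X) x) (hY : MDiffAt (T% Y) x) (hZ : MDiffAt (T% Z) x) :
    inner ℝ (leviCivitaFun Y x (X x)) (Z x) = 1 / 2 * koszul X Y Z x := by
  have h : koszulHom hY (X x) (Z x) = koszul X Y Z x :=
    TensorialAt.mkHom₂_apply (I := I) (F := E) (F' := E)
      (fun _ hZ ↦ koszul_tensorial₁ hY hZ) (fun _ hX ↦ koszul_tensorial₃ hX hY) hX hZ
  simp [leviCivitaFun, hY, rieszHom, inner_smul_left, h]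

theorem tangent_ext {x : M} {A B : TangentSpace I x →L[ℝ] TangentSpace I x}
    (h : ∀ X Z : Π x : M, TangentSpace I x, MDiffAt (T% X) x → MDiffAt (T% Z) x →
      (inner ℝ (A (X x)) (Z x) : ℝ) = inner ℝ (B (X x)) (Z x)) : A = B := by
  ext1 v
  refine ext_inner_right ℝ fun w ↦ ?_
  simpa using h (FiberBundle.extend E v) (FiberBundle.extend E w)
    (FiberBundle.mdifferentiableAt_extend ..) (FiberBundle.mdifferentiableAt_extend ..)

theorem koszul_add₂ {x : M} {X Y Y' Z : Π x : M, TangentSpace I x}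
    (hX : MDiffAt (T% X) x) (hY : MDiffAt (T% Y) x) (hY' : MDiffAt (T% Y') x)
    (hZ : MDiffAt (T% Z) x) :
    koszul X (Y + Y') Z x = koszul X Y Z x + koszul X Y' Z x := by
  have h1 := mvfderiv_fun_add (mdiffAt_inner hX hY) (mdiffAt_inner hX hY')
  have h2 := mvfderiv_fun_add (mdiffAt_inner hY hZ) (mdiffAt_inner hY' hZ)
  simp [koszul, VectorField.mlieBracket_add_right hY hY', VectorField.mlieBracket_add_left hY hY',
    inner_add_left, inner_add_right, h1, h2]
  ring

theorem koszul_smul₂ {x : M} {X Y Z : Π x : M, TangentSpace I x} {f : M → ℝ}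
    (hf : MDiffAt f x)
    (hX : MDiffAt (T% X) x) (hY : MDiffAt (T% Y) x) (hZ : MDiffAt (T% Z) x) :
    koszul X (f • Y) Z x
      = f x * koszul X Y Z x + 2 * (mvfderiv I f x (X x) * inner ℝ (Y x) (Z x)) := by
  have h1 := mvfderiv_fun_mul hf (mdiffAt_inner hX hY)
  have h2 := mvfderiv_fun_mul hf (mdiffAt_inner hY hZ)
  simp [koszul, VectorField.mlieBracket_smul_right hf hY, VectorField.mlieBracket_smul_left hf hY,
    inner_smul_left, inner_smul_right, inner_add_left, h1, h2]
  simp [real_inner_comm]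
  ring

variable (I M) in
/-- The Levi-Civita connection; `leviCivita I M Y x v` is `∇_v Y` at `x`. It is torsion-free and
compatible with the metric, see `torsion_leviCivita` and `metric_leviCivita`. -/
def leviCivita : CovariantDerivative I E (TangentSpace I : M → Type _) where
  toFun := leviCivitaFun
  isCovariantDerivativeOnUniv :=
    { add := fun {Y Y' x} hY hY' _ ↦ by
        refine tangent_ext fun X Z hX hZ ↦ ?_
        rw [inner_leviCivitaFun hX (mdifferentiableAt_add_section hY hY') hZ]
        simp [inner_add_left, inner_leviCivitaFun hX hY hZ, inner_leviCivitaFun hX hY' hZ,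
          koszul_add₂ hX hY hY' hZ]
        ring
      leibniz := fun {Y f x} hY hf _ ↦ by
        refine tangent_ext fun X Z hX hZ ↦ ?_
        rw [inner_leviCivitaFun hX (hf.smul_section hY) hZ]
        simp [inner_add_left, inner_smul_left, inner_leviCivitaFun hX hY hZ,
          koszul_smul₂ hf hX hY hZ]
        ring }

theorem inner_leviCivita {x : M} {X Y Z : Π x : M, TangentSpace I x}
    (hX : MDiffAt (T% X) x) (hY : MDiffAt (T% Y) x) (hZ : MDiffAt (T% Z) x) :
    inner ℝ (leviCivita I M Y x (X x)) (Z x) = 1 / 2 * koszul X Y Z x :=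
  inner_leviCivitaFun hX hY hZ

theorem torsion_leviCivita : (leviCivita I M).torsion = 0 := by
  rw [CovariantDerivative.torsion_eq_zero_iff]
  intro X Y x hX hY
  refine ext_inner_right ℝ fun w ↦ ?_
  have hZ : MDiffAt (T% (FiberBundle.extend E w)) x := FiberBundle.mdifferentiableAt_extend ..
  have h1 := inner_leviCivita hX hY hZ
  have h2 := inner_leviCivita hY hX hZ
  have h3 := VectorField.mlieBracket_swap_apply (I := I) (V := Y) (W := X) (x := x)
  simp only [FiberBundle.extend_apply_self] at h1 h2
  rw [inner_sub_left, h1, h2]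
  simp only [koszul, h3, inner_neg_left, FiberBundle.extend_apply_self, real_inner_comm]
  ring

theorem metric_leviCivita {x : M} {X Y Z : Π x : M, TangentSpace I x}
    (hX : MDiffAt (T% X) x) (hY : MDiffAt (T% Y) x) (hZ : MDiffAt (T% Z) x) :
    mvfderiv I (fun y ↦ (inner ℝ (Y y) (Z y) : ℝ)) x (X x)
      = inner ℝ (leviCivita I M Y x (X x)) (Z x) + inner ℝ (Y x) (leviCivita I M Z x (X x)) := by
  have h1 := inner_leviCivita hX hY hZ
  have h2 := inner_leviCivita hX hZ hY
  have h3 := VectorField.mlieBracket_swap_apply (I := I) (V := Z) (W := Y) (x := x)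
  have h4 : inner ℝ (Y x) (leviCivita I M Z x (X x)) = 1 / 2 * koszul X Z Y x := by
    rw [real_inner_comm, h2]
  simp only [h1, h4]
  simp only [koszul, h3, inner_neg_left, real_inner_comm]
  ring

/-- The velocity of a curve. -/
def velocity (γ : ℝ → M) (t : ℝ) : TangentSpace I (γ t) :=
  mfderiv 𝓘(ℝ, ℝ) I γ t (1 : ℝ)

/-- The covariant derivative along `γ` of a vector field `V` along `γ`. Write
`V τ = ∑ vᵢ(τ) eᵢ(γ τ)` in the coordinate frame `eᵢ` of the chart at `γ t`; then it is
`∑ vᵢ'(t) eᵢ + ∑ vᵢ(t) ∇_{γ'(t)} eᵢ`. -/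
def covDerivAlong (γ : ℝ → M) (V : Π t : ℝ, TangentSpace I (γ t)) (t : ℝ) :
    TangentSpace I (γ t) :=
  (trivializationAt E (TangentSpace I : M → Type _) (γ t)).symm (γ t)
      (deriv (fun τ ↦
        (trivializationAt E (TangentSpace I : M → Type _) (γ t) ⟨γ τ, V τ⟩).2) t)
    + leviCivita I M (FiberBundle.extend E (V t)) (γ t) (velocity γ t)

/-- The covariant acceleration `∇_{γ'} γ'` of a curve. -/
def acceleration (γ : ℝ → M) (t : ℝ) : TangentSpace I (γ t) :=
  covDerivAlong γ (fun τ ↦ velocity γ τ) t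

variable (I) in
/-- `γ` is a geodesic on the set `s` of parameters. -/
def IsGeodesicOn (γ : ℝ → M) (s : Set ℝ) : Prop :=
  ContMDiffOn 𝓘(ℝ, ℝ) I ∞ γ s ∧ ∀ t ∈ s, acceleration (I := I) γ t = 0

/-- The Riemann curvature `R(X, Y)Z = ∇_X ∇_Y Z - ∇_Y ∇_X Z - ∇_{[X, Y]} Z`. -/
def riemannCurvature (X Y Z : Π x : M, TangentSpace I x) (x : M) : TangentSpace I x :=
  leviCivita I M (fun y ↦ leviCivita I M Z y (Y y)) x (X x)
    - leviCivita I M (fun y ↦ leviCivita I M Z y (X y)) x (Y x)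
    - leviCivita I M Z x (VectorField.mlieBracket I X Y x)

/-- The sectional curvature of the plane spanned by `v` and `w`. -/
def sectionalCurvature {x : M} (v w : TangentSpace I x) : ℝ :=
  inner ℝ (riemannCurvature (FiberBundle.extend E v) (FiberBundle.extend E w)
      (FiberBundle.extend E w) x) v
    / (inner ℝ v v * inner ℝ w w - inner ℝ v w ^ 2)

end

section Surface

variable {M : Type*} [TopologicalSpace M] [ChartedSpace (EuclideanSpace ℝ (Fin 2)) M]

/-- The `i`-th coordinate vector at `x` of the chart at `x`. -/
def coordVec (x : M) (i : Fin 2) : TangentSpace (𝓡 2) x :=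
  (EuclideanSpace.single i (1 : ℝ) : EuclideanSpace ℝ (Fin 2))

/-- The Gaussian curvature of a surface: the sectional curvature of the tangent plane, computed in
the basis of coordinate vectors. -/
def gaussianCurvature [IsManifold (𝓡 2) ∞ M]
    [RiemannianBundle (fun x : M ↦ TangentSpace (𝓡 2) x)]
    [IsContMDiffRiemannianBundle (𝓡 2) ∞ (EuclideanSpace ℝ (Fin 2))
      (fun x : M ↦ TangentSpace (𝓡 2) x)] (x : M) : ℝ :=
  sectionalCurvature (coordVec x 0) (coordVec x 1)

variable (M) in
/-- An orientation of a surface: orientations of the tangent planes such that every point has a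
neighbourhood with a continuous positively oriented frame. -/
structure SurfaceOrientation [IsManifold (𝓡 2) ∞ M] where
  /-- The orientation of the tangent plane. -/
  orient : Π x : M, Orientation ℝ (TangentSpace (𝓡 2) x) (Fin 2)
  exists_frame : ∀ x : M, ∃ U ∈ 𝓝 x, ∃ Y : Fin 2 → Π y : M, TangentSpace (𝓡 2) y,
    (∀ i, ContinuousOn (fun y ↦ (⟨y, Y i y⟩ : TangentBundle (𝓡 2) M)) U) ∧
    ∀ y ∈ U, ∃ b : Module.Basis (Fin 2) ℝ (TangentSpace (𝓡 2) y),
      (∀ i, b i = Y i y) ∧ b.orientation = orient y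

/-- `(v, w)` is a positively oriented basis of the tangent plane. -/
def SurfaceOrientation.IsPositive [IsManifold (𝓡 2) ∞ M] (o : SurfaceOrientation M) {x : M}
    (v w : TangentSpace (𝓡 2) x) : Prop :=
  ∃ b : Module.Basis (Fin 2) ℝ (TangentSpace (𝓡 2) x),
    b 0 = v ∧ b 1 = w ∧ b.orientation = o.orient x

variable [IsManifold (𝓡 2) ∞ M] [RiemannianBundle (fun x : M ↦ TangentSpace (𝓡 2) x)]

/-- `(v, w)` is a positively oriented orthonormal basis of the tangent plane. -/
def SurfaceOrientation.IsPositiveOrthonormal (o : SurfaceOrientation M) {x : M}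
    (v w : TangentSpace (𝓡 2) x) : Prop :=
  inner ℝ v v = (1 : ℝ) ∧ inner ℝ v w = (0 : ℝ) ∧ inner ℝ w w = (1 : ℝ) ∧ o.IsPositive v w

/-- On the interval `(a, b)`, the curve `γ` is a level curve of `f` parametrized by arc length. -/
def IsLevelCurve (f : M → ℝ) (γ : ℝ → M) (a b : ℝ) : Prop :=
  ContMDiffOn 𝓘(ℝ, ℝ) (𝓡 2) 2 γ (Set.Ioo a b) ∧
  (∀ t ∈ Set.Ioo a b, inner ℝ (velocity (I := 𝓡 2) γ t) (velocity (I := 𝓡 2) γ t) = (1 : ℝ)) ∧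
  ∀ t ∈ Set.Ioo a b, ∀ t' ∈ Set.Ioo a b, f (γ t) = f (γ t')

/-- On the interval `(a, b)`, the curve `γ` is an arc, parametrized by arc length, of a circle of
signed geodesic curvature `κ`, a constant: `∇_{γ'} γ' = κ N`, where `N` is the unit normal for
which `(γ', N)` is positively oriented. -/
def IsCircle [IsContMDiffRiemannianBundle (𝓡 2) ∞ (EuclideanSpace ℝ (Fin 2))
      (fun x : M ↦ TangentSpace (𝓡 2) x)]
    (o : SurfaceOrientation M) (γ : ℝ → M) (a b κ : ℝ) : Prop :=
  ContMDiffOn 𝓘(ℝ, ℝ) (𝓡 2) 2 γ (Set.Ioo a b) ∧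
  ∀ t ∈ Set.Ioo a b, ∃ N : TangentSpace (𝓡 2) (γ t),
    o.IsPositiveOrthonormal (velocity γ t) N ∧ acceleration γ t = κ • N

/-- The coordinate vector field `X_u` of a parametrization `X = X(u, s)`. -/
def partialU (X : ℝ × ℝ → M) (u s : ℝ) : TangentSpace (𝓡 2) (X (u, s)) :=
  mfderiv 𝓘(ℝ, ℝ × ℝ) (𝓡 2) X (u, s) ((1, 0) : ℝ × ℝ)

/-- The coordinate vector field `X_s` of a parametrization `X = X(u, s)`. -/
def partialS (X : ℝ × ℝ → M) (u s : ℝ) : TangentSpace (𝓡 2) (X (u, s)) :=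
  mfderiv 𝓘(ℝ, ℝ × ℝ) (𝓡 2) X (u, s) ((0, 1) : ℝ × ℝ)

end Surface

end RiemSurface

end

namespace RiemSurface

/-! Write `e = X₁`, `f = X₂` and let ω(v) = ⟨∇_v e, f⟩ be the connection form, so that ∇e = ω f, ∇f
= -ω e and [e, f] = -ω(e) e - ω(f) f. Everything follows from the two functions ω(e) and ω(f).

The integral curves of f are level curves of K, with velocity f and normal -e, so the curvature
hypothesis says ω(f) = κ = 3 eK / (8(c - K)). Since κ and K are both constant along these curves,
f(eK) = 0. Hence [e, f] annihilates K, and as eK = |∇K| ≠ 0 this forces ω(e) = 0. These two values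
are the connection table, and they make the integral curves of e geodesics
(`circularFrame_of_isCircle`). In any orthonormal frame K = f(ω(e)) - e(ω(f)) - ω(e)² - ω(f)²
(`gaussianCurvature_eq`); here it reads K = -eκ - κ², which after clearing denominators is the
differential equation (`deriv_deriv_left`).

For the coordinates one needs functions with du(e) = 1, du(f) = 0 and ds(e) = κ s, ds(f) = 1. The
first pair is integrable because ω(e) = 0. The second is not a closed form with known coefficients,
but B = (c - K)^{3/8} satisfies eB = -κB, fB = 0, so v = B s must satisfy ev = 0, fv = B, and this
system is integrable. A Poincaré lemma in a frame (`exists_primitive`) gives u and v, and the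
inverse function theorem (`exists_coordinates`) turns (u, s) into a parametrization with X_s = f and
X_u = e - κ s f. The metric coefficients are then inner products in an orthonormal frame.

Smoothness of K and of e is not given and has to be extracted from the smoothness of f alone
(`orthonormalFrameOn_mgradient`). -/

theorem minSmoothness_two_le_infty : minSmoothness ℝ 2 ≤ ∞ := by
  rw [minSmoothness_of_isRCLikeNormedField]
  exact WithTop.coe_le_coe.2 le_top

/-! ### Vector fields, derivations and brackets read in a chart. -/

section ChartReading

variable {E : Type*} [NormedAddCommGroup E] [NormedSpace ℝ E] [FiniteDimensional ℝ E]
  {H : Type*} [TopologicalSpace H] {I : ModelWithCorners ℝ E H} [I.Boundaryless]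
  {M : Type*} [TopologicalSpace M] [ChartedSpace H M] [IsManifold I ∞ M]

/-- A vector field read in the chart at `p`. -/
noncomputable def chartField (p : M) (X : Π x : M, TangentSpace I x) : E → E :=
  VectorField.mpullback 𝓘(ℝ, E) I (extChartAt I p).symm X

theorem isInvertible_mfderiv_extChartAt_symm {p : M} {y : E} (hy : y ∈ (extChartAt I p).target) :
    (mfderiv 𝓘(ℝ, E) I (extChartAt I p).symm y).IsInvertible := by
  have := isInvertible_mfderivWithin_extChartAt_symm (I := I) hy
  rwa [I.range_eq_univ, mfderivWithin_univ] at this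

theorem contMDiffAt_extChartAt_symm_of_mem {p : M} {y : E} (hy : y ∈ (extChartAt I p).target) :
    ContMDiffAt 𝓘(ℝ, E) I ∞ (extChartAt I p).symm y :=
  (contMDiffOn_extChartAt_symm p).contMDiffAt ((isOpen_extChartAt_target p).mem_nhds hy)

theorem mfderiv_extChartAt_symm_chartField {p : M} {y : E} (hy : y ∈ (extChartAt I p).target)
    (X : Π x : M, TangentSpace I x) :
    mfderiv 𝓘(ℝ, E) I (extChartAt I p).symm y (chartField p X y :) = X ((extChartAt I p).symm y) := by
  obtain ⟨e, he⟩ := isInvertible_mfderiv_extChartAt_symm (I := I) hy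
  change mfderiv 𝓘(ℝ, E) I (extChartAt I p).symm y
    ((mfderiv 𝓘(ℝ, E) I (extChartAt I p).symm y).inverse (X ((extChartAt I p).symm y))) = _
  rw [← he, ContinuousLinearMap.inverse_equiv]
  exact e.apply_symm_apply _

theorem fderiv_comp_extChartAt_symm_chartField {p : M} {y : E}
    (hy : y ∈ (extChartAt I p).target) (X : Π x : M, TangentSpace I x) {f : M → ℝ}
    (hf : MDiffAt f ((extChartAt I p).symm y)) :
    fderiv ℝ (f ∘ (extChartAt I p).symm) y (chartField p X y)
      = mvfderiv I f ((extChartAt I p).symm y) (X ((extChartAt I p).symm y)) := by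
  have h := mvfderiv_comp_apply (I := I) (I' := 𝓘(ℝ, E)) y hf
    ((contMDiffAt_extChartAt_symm_of_mem hy).mdifferentiableAt (by simp)) (chartField p X y :)
  rw [mfderiv_extChartAt_symm_chartField hy] at h
  rw [← h, mvfderiv, mfderiv_eq_fderiv]
  rfl

theorem contDiffAt_chartField {p : M} {y : E} (hy : y ∈ (extChartAt I p).target)
    {X : Π x : M, TangentSpace I x}
    (hX : CMDiffAt ∞ (T% X) ((extChartAt I p).symm y)) :
    ContDiffAt ℝ ∞ (chartField p X) y :=
  contMDiffAt_vectorSpace_iff_contDiffAt.1 (ContMDiffAt.mpullback_vectorField_preimage hX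
    (contMDiffAt_extChartAt_symm_of_mem hy) (isInvertible_mfderiv_extChartAt_symm hy)
    (by exact_mod_cast le_top))

theorem contDiffAt_comp_extChartAt_symm {F : Type*} [NormedAddCommGroup F] [NormedSpace ℝ F]
    {p : M} {y : E} (hy : y ∈ (extChartAt I p).target)
    {f : M → F} (hf : CMDiffAt ∞ f ((extChartAt I p).symm y)) :
    ContDiffAt ℝ ∞ (f ∘ (extChartAt I p).symm) y :=
  (hf.comp y (contMDiffAt_extChartAt_symm_of_mem hy)).contDiffAt

/-- Naturality of the bracket under pullback; it lets identities between brackets be proved in the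
model space. -/
theorem lieBracket_chartField {p : M} {y : E} (hy : y ∈ (extChartAt I p).target)
    {X Y : Π x : M, TangentSpace I x}
    (hX : MDiffAt (T% X) ((extChartAt I p).symm y))
    (hY : MDiffAt (T% Y) ((extChartAt I p).symm y)) :
    VectorField.lieBracket ℝ (chartField p X) (chartField p Y) y
      = chartField p (VectorField.mlieBracket I X Y) y := by
  have : IsManifold I (minSmoothness ℝ 2) M := .of_le (n := ∞) minSmoothness_two_le_infty
  have h := VectorField.mpullback_mlieBracket (I := 𝓘(ℝ, E)) (n := ∞) hX hY
    (contMDiffAt_extChartAt_symm_of_mem hy) minSmoothness_two_le_infty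
  rw [← VectorField.mlieBracketWithin_univ (I := 𝓘(ℝ, E)),
    VectorField.mlieBracketWithin_eq_lieBracketWithin] at h
  rw [← VectorField.lieBracketWithin_univ]
  exact h.symm

theorem contMDiffAt_of_comp_extChartAt_symm {F : Type*} [NormedAddCommGroup F] [NormedSpace ℝ F]
    {p : M} {f : M → F}
    (hf : ContDiffAt ℝ ∞ (f ∘ (extChartAt I p).symm) (extChartAt I p p)) : CMDiffAt ∞ f p := by
  have h := hf.contMDiffAt.comp p (contMDiffAt_extChartAt (I := I) (n := ∞) (x := p))
  refine h.congr_of_eventuallyEq ?_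
  filter_upwards [extChartAt_source_mem_nhds (I := I) p] with x hx
  exact congrArg f ((extChartAt I p).left_inv hx).symm

theorem eventually_mdifferentiableAt {F : Type*} [NormedAddCommGroup F] [NormedSpace ℝ F]
    {x : M} {f : M → F} (hf : CMDiffAt ∞ f x) :
    ∀ᶠ y in 𝓝 x, MDiffAt f y :=
  ((contMDiffAt_iff_contMDiffAt_nhds (by simp)).1 (hf.of_le (m := 1) (by simp))).mono
    fun _ h ↦ h.mdifferentiableAt (by simp)

theorem mvfderiv_congr {F : Type*} [NormedAddCommGroup F] [NormedSpace ℝ F] {p : M} {f g : M → F}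
    (h : f =ᶠ[𝓝 p] g) : mvfderiv I f p = mvfderiv I g p := by
  have := h.mfderiv_eq (I := I) (I' := 𝓘(ℝ, F))
  ext v
  simp only [mvfderiv, ContinuousLinearMap.comp_apply, this]
  rfl

/-- The derivative of a smooth function along a smooth vector field is smooth. -/
theorem contMDiffAt_mvfderiv_apply {x : M} {f : M → ℝ} {X : Π x : M, TangentSpace I x}
    (hf : CMDiffAt ∞ f x) (hX : CMDiffAt ∞ (T% X) x) :
    CMDiffAt ∞ (fun y ↦ mvfderiv I f y (X y)) x := by
  refine contMDiffAt_of_comp_extChartAt_symm ?_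
  have hx : (extChartAt I x).symm (extChartAt I x x) = x := extChartAt_to_inv x
  have hf' := contDiffAt_comp_extChartAt_symm (I := I) (mem_extChartAt_target x) (hx.symm ▸ hf)
  have hX' := contDiffAt_chartField (I := I) (mem_extChartAt_target x) (hx.symm ▸ hX)
  -- In the chart the function is a Fréchet derivative applied to a smooth field; both factors are
  -- visibly smooth.
  refine ((hf'.fderiv_right (m := ∞) (by simp)).clm_apply hX').congr_of_eventuallyEq ?_
  have h1 : ∀ᶠ y in 𝓝 (extChartAt I x x), MDiffAt f ((extChartAt I x).symm y) :=
    (continuousAt_extChartAt_symm x).eventually (hx.symm ▸ eventually_mdifferentiableAt hf)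
  filter_upwards [h1, (isOpen_extChartAt_target x).mem_nhds (mem_extChartAt_target (I := I) x)]
    with y hy hy'
  exact (fderiv_comp_extChartAt_symm_chartField hy' X hy).symm

/-- The Lie bracket is the commutator of derivations. -/
theorem mvfderiv_apply_mlieBracket {x : M} {f : M → ℝ} {X Y : Π x : M, TangentSpace I x}
    (hf : CMDiffAt ∞ f x) (hX : CMDiffAt ∞ (T% X) x) (hY : CMDiffAt ∞ (T% Y) x) :
    mvfderiv I f x (VectorField.mlieBracket I X Y x)
      = mvfderiv I (fun y ↦ mvfderiv I f y (Y y)) x (X x)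
        - mvfderiv I (fun y ↦ mvfderiv I f y (X y)) x (Y x) := by
  have hx : (extChartAt I x).symm (extChartAt I x x) = x := extChartAt_to_inv x
  have hm := mem_extChartAt_target (I := I) x
  have hf0 := contDiffAt_comp_extChartAt_symm (I := I) hm (hx.symm ▸ hf)
  have hX0 := contDiffAt_chartField (I := I) hm (hx.symm ▸ hX)
  have hY0 := contDiffAt_chartField (I := I) hm (hx.symm ▸ hY)
  have h1 : ∀ᶠ y in 𝓝 (extChartAt I x x), MDiffAt f ((extChartAt I x).symm y) :=
    (continuousAt_extChartAt_symm x).eventually (hx.symm ▸ eventually_mdifferentiableAt hf)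
  have key (Z : Π x : M, TangentSpace I x) :
      (fun y ↦ fderiv ℝ (f ∘ (extChartAt I x).symm) y (chartField x Z y)) =ᶠ[𝓝 (extChartAt I x x)]
        (fun y ↦ mvfderiv I f y (Z y)) ∘ (extChartAt I x).symm := by
    filter_upwards [h1, (isOpen_extChartAt_target x).mem_nhds hm] with y hy hy'
    exact fderiv_comp_extChartAt_symm_chartField hy' Z hy
  have key2 (Z W : Π x : M, TangentSpace I x) (hZ : CMDiffAt ∞ (T% Z) x) :
      fderiv ℝ (fun y ↦ fderiv ℝ (f ∘ (extChartAt I x).symm) y (chartField x Z y))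
        (extChartAt I x x) (chartField x W (extChartAt I x x))
      = mvfderiv I (fun y ↦ mvfderiv I f y (Z y)) x (W x) := by
    have hfZ := (contMDiffAt_mvfderiv_apply hf hZ).mdifferentiableAt (by simp)
    rw [(key Z).fderiv_eq,
      fderiv_comp_extChartAt_symm_chartField hm W (hx.symm ▸ hfZ), hx]
  -- In the chart the claim is the symmetry of the second derivative; `key2` translates the iterated
  -- derivatives back.
  have hb := VectorField.fderiv_apply_lieBracket (V := chartField x X) (W := chartField x Y)
    hf0 minSmoothness_two_le_infty (hY0.differentiableAt (by simp)) (hX0.differentiableAt (by simp))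
  rw [lieBracket_chartField hm (hx.symm ▸ hX.mdifferentiableAt (by simp))
    (hx.symm ▸ hY.mdifferentiableAt (by simp)),
    fderiv_comp_extChartAt_symm_chartField hm _ (hx.symm ▸ hf.mdifferentiableAt (by simp)), hx,
    key2 Y X hY, key2 X Y hX] at hb
  exact hb

theorem contMDiffAt_mlieBracket {x : M} {X Y : Π x : M, TangentSpace I x}
    (hX : CMDiffAt ∞ (T% X) x) (hY : CMDiffAt ∞ (T% Y) x) :
    CMDiffAt ∞ (T% (VectorField.mlieBracket I X Y)) x := by
  have : IsManifold I (minSmoothness ℝ 2) M := .of_le (n := ∞) minSmoothness_two_le_infty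
  have : IsManifold I ((⊤ : ℕ∞) + 1) M := .of_le (n := ∞) (by simp)
  exact ContMDiffAt.mlieBracket_vectorField (m := ⊤) (n := ⊤) hX hY (by simp)

end ChartReading

end RiemSurface

namespace RiemSurface

/-! ### Orthonormal frames and their connection form. -/

section Frame

variable {M : Type*} [TopologicalSpace M] [ChartedSpace (EuclideanSpace ℝ (Fin 2)) M]
  [IsManifold (𝓡 2) ∞ M] [RiemannianBundle (fun x : M ↦ TangentSpace (𝓡 2) x)]

/-- A vector field is smooth at a point. -/
abbrev SmoothFieldAt (X : Π x : M, TangentSpace (𝓡 2) x) (x : M) : Prop :=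
  ContMDiffAt (𝓡 2) (𝓡 2).tangent ∞ (fun y ↦ (⟨y, X y⟩ : TangentBundle (𝓡 2) M)) x

/-- A vector field is differentiable at a point. -/
abbrev DiffFieldAt (X : Π x : M, TangentSpace (𝓡 2) x) (x : M) : Prop :=
  MDifferentiableAt (𝓡 2) (𝓡 2).tangent (fun y ↦ (⟨y, X y⟩ : TangentBundle (𝓡 2) M)) x

/-- A function is smooth at a point. -/
abbrev SmoothAt (F : M → ℝ) (x : M) : Prop := ContMDiffAt (𝓡 2) 𝓘(ℝ, ℝ) ∞ F x

/-- In a plane, a vector is determined by its components in an orthonormal pair. -/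
theorem eq_inner_smul_add_inner_smul {V : Type*} [NormedAddCommGroup V] [InnerProductSpace ℝ V]
    (hV : Module.finrank ℝ V = 2) {a b : V} (ha : inner ℝ a a = (1 : ℝ))
    (hab : inner ℝ a b = (0 : ℝ)) (hb : inner ℝ b b = (1 : ℝ)) (v : V) :
    v = (inner ℝ v a : ℝ) • a + (inner ℝ v b : ℝ) • b := by
  have hba : inner ℝ b a = (0 : ℝ) := by rw [real_inner_comm, hab]
  have : FiniteDimensional ℝ V := .of_finrank_pos (by omega)
  have ho : Orthonormal ℝ ![a, b] := by
    rw [orthonormal_iff_ite]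
    intro i j
    fin_cases i <;> fin_cases j <;>
      simp [hab, hba, -inner_self_eq_norm_sq_to_K, ha, hb]
  let B := basisOfOrthonormalOfCardEqFinrank ho (by simp [hV])
  have hB : Orthonormal ℝ B := by simpa [B] using ho
  have := (B.toOrthonormalBasis hB).sum_repr' v
  simpa [Fin.sum_univ_two, B, real_inner_comm] using this.symm

theorem finrank_tangentSpace (x : M) : Module.finrank ℝ (TangentSpace (𝓡 2) x) = 2 :=
  finrank_euclideanSpace_fin (𝕜 := ℝ) (n := 2)

/-- A smooth orthonormal frame over an open set. -/
structure OrthonormalFrameOn (U : Set M) (e f : Π x : M, TangentSpace (𝓡 2) x) : Prop where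
  isOpen : IsOpen U
  smooth_left : ∀ x ∈ U, SmoothFieldAt e x
  smooth_right : ∀ x ∈ U, SmoothFieldAt f x
  inner_left : ∀ x ∈ U, inner ℝ (e x) (e x) = (1 : ℝ)
  inner_left_right : ∀ x ∈ U, inner ℝ (e x) (f x) = (0 : ℝ)
  inner_right : ∀ x ∈ U, inner ℝ (f x) (f x) = (1 : ℝ)

variable {U : Set M} {e f : Π x : M, TangentSpace (𝓡 2) x}

theorem OrthonormalFrameOn.expand (h : OrthonormalFrameOn U e f) {x : M} (hx : x ∈ U)
    (v : TangentSpace (𝓡 2) x) :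
    v = (inner ℝ v (e x) : ℝ) • e x + (inner ℝ v (f x) : ℝ) • f x :=
  eq_inner_smul_add_inner_smul (finrank_tangentSpace x) (h.inner_left x hx)
    (h.inner_left_right x hx) (h.inner_right x hx) v

theorem OrthonormalFrameOn.ext (h : OrthonormalFrameOn U e f) {x : M} (hx : x ∈ U)
    {v w : TangentSpace (𝓡 2) x} (h0 : inner ℝ v (e x) = (inner ℝ w (e x) : ℝ))
    (h1 : inner ℝ v (f x) = (inner ℝ w (f x) : ℝ)) : v = w := by
  rw [h.expand hx v, h.expand hx w, h0, h1]

theorem OrthonormalFrameOn.inner_eq (h : OrthonormalFrameOn U e f) {x : M} (hx : x ∈ U)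
    (v w : TangentSpace (𝓡 2) x) :
    (inner ℝ v w : ℝ) = inner ℝ v (e x) * inner ℝ w (e x) + inner ℝ v (f x) * inner ℝ w (f x) := by
  conv_lhs => rw [h.expand hx w]
  simp only [inner_add_right, inner_smul_right]
  ring

theorem OrthonormalFrameOn.mdiffAt_left (h : OrthonormalFrameOn U e f) {x : M} (hx : x ∈ U) :
    DiffFieldAt e x := (h.smooth_left x hx).mdifferentiableAt (by simp)

theorem OrthonormalFrameOn.mdiffAt_right (h : OrthonormalFrameOn U e f) {x : M} (hx : x ∈ U) :
    DiffFieldAt f x := (h.smooth_right x hx).mdifferentiableAt (by simp)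

theorem OrthonormalFrameOn.mono (h : OrthonormalFrameOn U e f) {V : Set M} (hV : IsOpen V)
    (hVU : V ⊆ U) : OrthonormalFrameOn V e f :=
  ⟨hV, fun x hx ↦ h.smooth_left x (hVU hx), fun x hx ↦ h.smooth_right x (hVU hx),
    fun x hx ↦ h.inner_left x (hVU hx), fun x hx ↦ h.inner_left_right x (hVU hx),
    fun x hx ↦ h.inner_right x (hVU hx)⟩

theorem mvfderiv_eq_zero_of_eventually_const {x : M} {F : M → ℝ} {a : ℝ} (h : ∀ᶠ y in 𝓝 x, F y = a) :
    mvfderiv (𝓡 2) F x = 0 := by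
  have h' : F =ᶠ[𝓝 x] fun _ ↦ a := h
  rw [mvfderiv_congr h', mvfderiv_const]

variable [IsContMDiffRiemannianBundle (𝓡 2) ∞ (EuclideanSpace ℝ (Fin 2))
      (fun x : M ↦ TangentSpace (𝓡 2) x)]

theorem contMDiffAt_inner {x : M} {X Y : Π x : M, TangentSpace (𝓡 2) x}
    (hX : SmoothFieldAt X x) (hY : SmoothFieldAt Y x) :
    SmoothAt (fun y ↦ (inner ℝ (X y) (Y y) : ℝ)) x :=
  ContMDiffAt.inner_bundle (E := fun x : M ↦ TangentSpace (𝓡 2) x) hX hY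

/-- Compatibility of the connection with the metric, for a single direction. -/
theorem mvfderiv_inner_apply {x : M} {Y Z : Π x : M, TangentSpace (𝓡 2) x}
    (hY : DiffFieldAt Y x) (hZ : DiffFieldAt Z x) (v : TangentSpace (𝓡 2) x) :
    mvfderiv (𝓡 2) (fun y ↦ (inner ℝ (Y y) (Z y) : ℝ)) x v
      = inner ℝ (leviCivita (𝓡 2) M Y x v) (Z x) + inner ℝ (Y x) (leviCivita (𝓡 2) M Z x v) := by
  have := metric_leviCivita (X := FiberBundle.extend (EuclideanSpace ℝ (Fin 2)) v)
    (FiberBundle.mdifferentiableAt_extend ..) hY hZ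
  simpa using this

theorem leviCivita_sub_leviCivita {x : M} {X Y : Π x : M, TangentSpace (𝓡 2) x}
    (hX : DiffFieldAt X x) (hY : DiffFieldAt Y x) :
    leviCivita (𝓡 2) M Y x (X x) - leviCivita (𝓡 2) M X x (Y x)
      = VectorField.mlieBracket (𝓡 2) X Y x :=
  (leviCivita (𝓡 2) M).torsion_eq_zero_iff.1 torsion_leviCivita hX hY

/-- The connection form of a frame. -/
noncomputable def connForm (e f : Π x : M, TangentSpace (𝓡 2) x) (x : M)
    (v : TangentSpace (𝓡 2) x) : ℝ :=
  inner ℝ (leviCivita (𝓡 2) M e x v) (f x)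

namespace OrthonormalFrameOn

/-- Differentiating ⟨e, e⟩ = 1 kills the e-component; the f-component is `connForm` by definition.
-/
theorem leviCivita_left (h : OrthonormalFrameOn U e f) {x : M} (hx : x ∈ U)
    (v : TangentSpace (𝓡 2) x) : leviCivita (𝓡 2) M e x v = connForm e f x v • f x := by
  have h1 := mvfderiv_inner_apply (h.mdiffAt_left hx) (h.mdiffAt_left hx) v
  rw [mvfderiv_eq_zero_of_eventually_const (a := 1)
    (Filter.eventually_of_mem (h.isOpen.mem_nhds hx) h.inner_left),
    real_inner_comm] at h1
  have h2 : inner ℝ (e x) (leviCivita (𝓡 2) M e x v) = (0 : ℝ) := by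
    have : (0 : ℝ) = _ := h1
    linarith
  refine h.ext hx ?_ ?_
  · rw [real_inner_comm, h2, inner_smul_left, real_inner_comm, h.inner_left_right x hx]
    simp
  · rw [inner_smul_left, h.inner_right x hx]
    simp [connForm]

/-- As for e, with ⟨e, f⟩ = 0 differentiated to identify the remaining component as the negative of
`connForm`. -/
theorem leviCivita_right (h : OrthonormalFrameOn U e f) {x : M} (hx : x ∈ U)
    (v : TangentSpace (𝓡 2) x) : leviCivita (𝓡 2) M f x v = -connForm e f x v • e x := by
  have h1 := mvfderiv_inner_apply (h.mdiffAt_right hx) (h.mdiffAt_right hx) v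
  rw [mvfderiv_eq_zero_of_eventually_const (a := 1)
    (Filter.eventually_of_mem (h.isOpen.mem_nhds hx) h.inner_right),
    real_inner_comm] at h1
  have h2 : inner ℝ (f x) (leviCivita (𝓡 2) M f x v) = (0 : ℝ) := by
    have : (0 : ℝ) = _ := h1
    linarith
  have h3 := mvfderiv_inner_apply (h.mdiffAt_left hx) (h.mdiffAt_right hx) v
  rw [mvfderiv_eq_zero_of_eventually_const (a := 0)
    (Filter.eventually_of_mem (h.isOpen.mem_nhds hx) h.inner_left_right)] at h3
  have h4 : (0 : ℝ) = connForm e f x v + inner ℝ (e x) (leviCivita (𝓡 2) M f x v) := h3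
  refine h.ext hx ?_ ?_
  · rw [real_inner_comm, inner_smul_left, h.inner_left x hx]
    simp only [map_neg, conj_trivial, mul_one]
    linarith
  · rw [real_inner_comm, h2, inner_smul_left, h.inner_left_right x hx]
    simp

/-- The first component of a covariant derivative in a frame. -/
theorem inner_leviCivita_left (h : OrthonormalFrameOn U e f) {x : M} (hx : x ∈ U)
    {Z : Π x : M, TangentSpace (𝓡 2) x} (hZ : DiffFieldAt Z x) (v : TangentSpace (𝓡 2) x) :
    inner ℝ (leviCivita (𝓡 2) M Z x v) (e x)
      = mvfderiv (𝓡 2) (fun y ↦ (inner ℝ (Z y) (e y) : ℝ)) x v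
        - connForm e f x v * inner ℝ (Z x) (f x) := by
  rw [mvfderiv_inner_apply hZ (h.mdiffAt_left hx) v, h.leviCivita_left hx, inner_smul_right]
  ring

/-- The second component of a covariant derivative in a frame. -/
theorem inner_leviCivita_right (h : OrthonormalFrameOn U e f) {x : M} (hx : x ∈ U)
    {Z : Π x : M, TangentSpace (𝓡 2) x} (hZ : DiffFieldAt Z x) (v : TangentSpace (𝓡 2) x) :
    inner ℝ (leviCivita (𝓡 2) M Z x v) (f x)
      = mvfderiv (𝓡 2) (fun y ↦ (inner ℝ (Z y) (f y) : ℝ)) x v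
        + connForm e f x v * inner ℝ (Z x) (e x) := by
  rw [mvfderiv_inner_apply hZ (h.mdiffAt_right hx) v, h.leviCivita_right hx, inner_smul_right]
  ring

theorem connForm_apply (h : OrthonormalFrameOn U e f) {x : M} (hx : x ∈ U)
    (v : TangentSpace (𝓡 2) x) :
    connForm e f x v = inner ℝ v (e x) * connForm e f x (e x)
      + inner ℝ v (f x) * connForm e f x (f x) := by
  conv_lhs => rw [h.expand hx v]
  simp only [connForm, map_add, map_smul, inner_add_left, inner_smul_left]
  simp

/-- Vanishing torsion turns the bracket into a difference of covariant derivatives. Read backwards,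
it expresses the connection coefficients through brackets, whose smoothness is known; this is how
smoothness of the connection is obtained from its pointwise Koszul definition. -/
theorem mlieBracket_eq (h : OrthonormalFrameOn U e f) {x : M} (hx : x ∈ U) :
    VectorField.mlieBracket (𝓡 2) e f x
      = -connForm e f x (e x) • e x - connForm e f x (f x) • f x := by
  rw [← leviCivita_sub_leviCivita (h.mdiffAt_left hx) (h.mdiffAt_right hx), h.leviCivita_left hx,
    h.leviCivita_right hx]

theorem connForm_left (h : OrthonormalFrameOn U e f) {x : M} (hx : x ∈ U) :
    connForm e f x (e x) = -inner ℝ (VectorField.mlieBracket (𝓡 2) e f x) (e x) := by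
  rw [h.mlieBracket_eq hx, inner_sub_left, inner_smul_left, inner_smul_left, h.inner_left x hx,
    real_inner_comm, h.inner_left_right x hx]
  simp

theorem connForm_right (h : OrthonormalFrameOn U e f) {x : M} (hx : x ∈ U) :
    connForm e f x (f x) = -inner ℝ (VectorField.mlieBracket (𝓡 2) e f x) (f x) := by
  rw [h.mlieBracket_eq hx, inner_sub_left, inner_smul_left, inner_smul_left, h.inner_right x hx,
    h.inner_left_right x hx]
  simp

theorem contMDiffAt_connForm_left (h : OrthonormalFrameOn U e f) {x : M} (hx : x ∈ U) :
    SmoothAt (fun y ↦ connForm e f y (e y)) x := by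
  refine (contMDiffAt_inner (contMDiffAt_mlieBracket (h.smooth_left x hx) (h.smooth_right x hx))
    (h.smooth_left x hx)).neg.congr_of_eventuallyEq ?_
  filter_upwards [h.isOpen.mem_nhds hx] with y hy using h.connForm_left hy

theorem contMDiffAt_connForm_right (h : OrthonormalFrameOn U e f) {x : M} (hx : x ∈ U) :
    SmoothAt (fun y ↦ connForm e f y (f y)) x := by
  refine (contMDiffAt_inner (contMDiffAt_mlieBracket (h.smooth_left x hx) (h.smooth_right x hx))
    (h.smooth_right x hx)).neg.congr_of_eventuallyEq ?_
  filter_upwards [h.isOpen.mem_nhds hx] with y hy using h.connForm_right hy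

theorem contMDiffAt_of_inner (h : OrthonormalFrameOn U e f) {x : M} (hx : x ∈ U)
    {Z : Π x : M, TangentSpace (𝓡 2) x}
    (h0 : SmoothAt (fun y ↦ (inner ℝ (Z y) (e y) : ℝ)) x)
    (h1 : SmoothAt (fun y ↦ (inner ℝ (Z y) (f y) : ℝ)) x) : SmoothFieldAt Z x := by
  refine ((h0.smul_section (h.smooth_left x hx)).add_section
    (h1.smul_section (h.smooth_right x hx))).congr_of_eventuallyEq ?_
  filter_upwards [h.isOpen.mem_nhds hx] with y hy
  congr 1
  exact h.expand hy (Z y)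

theorem contMDiffAt_connForm_apply (h : OrthonormalFrameOn U e f) {x : M} (hx : x ∈ U)
    {W : Π x : M, TangentSpace (𝓡 2) x} (hW : SmoothFieldAt W x) :
    SmoothAt (fun y ↦ connForm e f y (W y)) x := by
  refine (((contMDiffAt_inner hW (h.smooth_left x hx)).mul (h.contMDiffAt_connForm_left hx)).add
    ((contMDiffAt_inner hW (h.smooth_right x hx)).mul
      (h.contMDiffAt_connForm_right hx))).congr_of_eventuallyEq ?_
  filter_upwards [h.isOpen.mem_nhds hx] with y hy using h.connForm_apply hy _

/-- The covariant derivative of a smooth field along a smooth field is smooth. -/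
theorem contMDiffAt_leviCivita (h : OrthonormalFrameOn U e f) {x : M} (hx : x ∈ U)
    {W Z : Π x : M, TangentSpace (𝓡 2) x} (hW : SmoothFieldAt W x)
    (hZ : ∀ y ∈ U, SmoothFieldAt Z y) :
    SmoothFieldAt (fun y ↦ leviCivita (𝓡 2) M Z y (W y)) x := by
  have hω := h.contMDiffAt_connForm_apply hx hW
  refine h.contMDiffAt_of_inner hx ?_ ?_
  · refine ((contMDiffAt_mvfderiv_apply (contMDiffAt_inner (hZ x hx) (h.smooth_left x hx)) hW).sub
      (hω.mul (contMDiffAt_inner (hZ x hx) (h.smooth_right x hx)))).congr_of_eventuallyEq ?_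
    filter_upwards [h.isOpen.mem_nhds hx] with y hy using
      h.inner_leviCivita_left hy ((hZ y hy).mdifferentiableAt (by simp)) _
  · refine ((contMDiffAt_mvfderiv_apply (contMDiffAt_inner (hZ x hx) (h.smooth_right x hx)) hW).add
      (hω.mul (contMDiffAt_inner (hZ x hx) (h.smooth_left x hx)))).congr_of_eventuallyEq ?_
    filter_upwards [h.isOpen.mem_nhds hx] with y hy using
      h.inner_leviCivita_right hy ((hZ y hy).mdifferentiableAt (by simp)) _

end OrthonormalFrameOn

end Frame

end RiemSurface

namespace RiemSurface

/-! ### The structure equation and the Gaussian curvature in a frame. -/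

section Curvature

variable {M : Type*} [TopologicalSpace M] [ChartedSpace (EuclideanSpace ℝ (Fin 2)) M]
  [IsManifold (𝓡 2) ∞ M] [RiemannianBundle (fun x : M ↦ TangentSpace (𝓡 2) x)]
  [IsContMDiffRiemannianBundle (𝓡 2) ∞ (EuclideanSpace ℝ (Fin 2))
      (fun x : M ↦ TangentSpace (𝓡 2) x)]
  {U : Set M} {e f : Π x : M, TangentSpace (𝓡 2) x}

/-- The exterior derivative of the connection form. -/
noncomputable def curvForm (e f V W : Π x : M, TangentSpace (𝓡 2) x) (x : M) : ℝ :=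
  mvfderiv (𝓡 2) (fun y ↦ connForm e f y (W y)) x (V x)
    - mvfderiv (𝓡 2) (fun y ↦ connForm e f y (V y)) x (W x)
    - connForm e f x (VectorField.mlieBracket (𝓡 2) V W x)

theorem smoothAt_mul {x : M} {F G : M → ℝ} (hF : SmoothAt F x) (hG : SmoothAt G x) :
    SmoothAt (fun y ↦ F y * G y) x :=
  hF.mul hG

theorem mvfderiv_mul_apply {x : M} {F G : M → ℝ} (hF : SmoothAt F x) (hG : SmoothAt G x)
    (v : TangentSpace (𝓡 2) x) :
    mvfderiv (𝓡 2) (fun y ↦ F y * G y) x v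
      = F x * mvfderiv (𝓡 2) G x v + mvfderiv (𝓡 2) F x v * G x := by
  rw [mvfderiv_fun_mul (hF.mdifferentiableAt (by simp)) (hG.mdifferentiableAt (by simp))]
  simp
  ring

theorem mvfderiv_add_apply {x : M} {F G : M → ℝ} (hF : SmoothAt F x) (hG : SmoothAt G x)
    (v : TangentSpace (𝓡 2) x) :
    mvfderiv (𝓡 2) (fun y ↦ F y + G y) x v = mvfderiv (𝓡 2) F x v + mvfderiv (𝓡 2) G x v := by
  rw [mvfderiv_fun_add (hF.mdifferentiableAt (by simp)) (hG.mdifferentiableAt (by simp))]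
  simp

theorem mvfderiv_sub_apply {x : M} {F G : M → ℝ} (hF : SmoothAt F x) (hG : SmoothAt G x)
    (v : TangentSpace (𝓡 2) x) :
    mvfderiv (𝓡 2) (fun y ↦ F y - G y) x v = mvfderiv (𝓡 2) F x v - mvfderiv (𝓡 2) G x v := by
  have := mvfderiv_sub (hF.mdifferentiableAt (by simp)) (hG.mdifferentiableAt (by simp))
  exact congr($this v)

namespace OrthonormalFrameOn

/-- The structure equation R(V, W) = dω(V, W) · (rotation by a right angle). In components of Z, the
second derivatives cancel against the ∇_{[V, W]} term, since the bracket is the commutator of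
derivations. The terms with one derivative of Z and the products ω(V)ω(W) cancel by antisymmetry,
and only dω remains. -/
theorem inner_riemannCurvature_left (h : OrthonormalFrameOn U e f) {x : M} (hx : x ∈ U)
    {V W Z : Π x : M, TangentSpace (𝓡 2) x} (hV : SmoothFieldAt V x) (hW : SmoothFieldAt W x)
    (hZ : ∀ y ∈ U, SmoothFieldAt Z y) :
    inner ℝ (riemannCurvature V W Z x) (e x) = -inner ℝ (Z x) (f x) * curvForm e f V W x := by
  have hZ' : ∀ y ∈ U, DiffFieldAt Z y := fun y hy ↦ (hZ y hy).mdifferentiableAt (by simp)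
  have hz0 := contMDiffAt_inner (hZ x hx) (h.smooth_left x hx)
  have hz1 := contMDiffAt_inner (hZ x hx) (h.smooth_right x hx)
  have key (W : Π x : M, TangentSpace (𝓡 2) x) (hW : SmoothFieldAt W x)
      (v : TangentSpace (𝓡 2) x) :
      mvfderiv (𝓡 2) (fun y ↦ (inner ℝ (leviCivita (𝓡 2) M Z y (W y)) (e y) : ℝ)) x v
        = mvfderiv (𝓡 2) (fun y ↦ mvfderiv (𝓡 2) (fun y ↦ (inner ℝ (Z y) (e y) : ℝ)) y (W y)) x v
          - (connForm e f x (W x) * mvfderiv (𝓡 2) (fun y ↦ (inner ℝ (Z y) (f y) : ℝ)) x v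
            + mvfderiv (𝓡 2) (fun y ↦ connForm e f y (W y)) x v * inner ℝ (Z x) (f x)) := by
    have hω := h.contMDiffAt_connForm_apply hx hW
    rw [← mvfderiv_mul_apply hω hz1, ← mvfderiv_sub_apply (contMDiffAt_mvfderiv_apply hz0 hW)
      (smoothAt_mul hω hz1)]
    refine congr($(mvfderiv_congr ?_) v)
    filter_upwards [h.isOpen.mem_nhds hx] with y hy using h.inner_leviCivita_left hy (hZ' y hy) _
  have hb := mvfderiv_apply_mlieBracket hz0 hV hW
  rw [riemannCurvature, inner_sub_left, inner_sub_left,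
    h.inner_leviCivita_left hx
      ((h.contMDiffAt_leviCivita hx hW hZ).mdifferentiableAt (by simp)),
    h.inner_leviCivita_left hx
      ((h.contMDiffAt_leviCivita hx hV hZ).mdifferentiableAt (by simp)),
    h.inner_leviCivita_left hx (hZ' x hx), key W hW, key V hV,
    h.inner_leviCivita_right hx (hZ' x hx), h.inner_leviCivita_right hx (hZ' x hx), hb, curvForm]
  ring

theorem inner_riemannCurvature_right (h : OrthonormalFrameOn U e f) {x : M} (hx : x ∈ U)
    {V W Z : Π x : M, TangentSpace (𝓡 2) x} (hV : SmoothFieldAt V x) (hW : SmoothFieldAt W x)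
    (hZ : ∀ y ∈ U, SmoothFieldAt Z y) :
    inner ℝ (riemannCurvature V W Z x) (f x) = inner ℝ (Z x) (e x) * curvForm e f V W x := by
  have hZ' : ∀ y ∈ U, DiffFieldAt Z y := fun y hy ↦ (hZ y hy).mdifferentiableAt (by simp)
  have hz0 := contMDiffAt_inner (hZ x hx) (h.smooth_left x hx)
  have hz1 := contMDiffAt_inner (hZ x hx) (h.smooth_right x hx)
  have key (W : Π x : M, TangentSpace (𝓡 2) x) (hW : SmoothFieldAt W x)
      (v : TangentSpace (𝓡 2) x) :
      mvfderiv (𝓡 2) (fun y ↦ (inner ℝ (leviCivita (𝓡 2) M Z y (W y)) (f y) : ℝ)) x v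
        = mvfderiv (𝓡 2) (fun y ↦ mvfderiv (𝓡 2) (fun y ↦ (inner ℝ (Z y) (f y) : ℝ)) y (W y)) x v
          + (connForm e f x (W x) * mvfderiv (𝓡 2) (fun y ↦ (inner ℝ (Z y) (e y) : ℝ)) x v
            + mvfderiv (𝓡 2) (fun y ↦ connForm e f y (W y)) x v * inner ℝ (Z x) (e x)) := by
    have hω := h.contMDiffAt_connForm_apply hx hW
    rw [← mvfderiv_mul_apply hω hz0, ← mvfderiv_add_apply (contMDiffAt_mvfderiv_apply hz1 hW)
      (smoothAt_mul hω hz0)]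
    refine congr($(mvfderiv_congr ?_) v)
    filter_upwards [h.isOpen.mem_nhds hx] with y hy using h.inner_leviCivita_right hy (hZ' y hy) _
  have hb := mvfderiv_apply_mlieBracket hz1 hV hW
  rw [riemannCurvature, inner_sub_left, inner_sub_left,
    h.inner_leviCivita_right hx
      ((h.contMDiffAt_leviCivita hx hW hZ).mdifferentiableAt (by simp)),
    h.inner_leviCivita_right hx
      ((h.contMDiffAt_leviCivita hx hV hZ).mdifferentiableAt (by simp)),
    h.inner_leviCivita_right hx (hZ' x hx), key W hW, key V hV,
    h.inner_leviCivita_left hx (hZ' x hx), h.inner_leviCivita_left hx (hZ' x hx), hb, curvForm]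
  ring

/-- The Gaussian curvature in terms of the connection coefficients of an orthonormal frame. -/
noncomputable def _root_.RiemSurface.frameCurvature
    (e f : Π x : M, TangentSpace (𝓡 2) x) (x : M) : ℝ :=
  mvfderiv (𝓡 2) (fun y ↦ connForm e f y (e y)) x (f x)
    - mvfderiv (𝓡 2) (fun y ↦ connForm e f y (f y)) x (e x)
    - connForm e f x (e x) ^ 2 - connForm e f x (f x) ^ 2

theorem mvfderiv_apply_expand (h : OrthonormalFrameOn U e f) {x : M} (hx : x ∈ U) (F : M → ℝ)
    (v : TangentSpace (𝓡 2) x) :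
    mvfderiv (𝓡 2) F x v = inner ℝ v (e x) * mvfderiv (𝓡 2) F x (e x)
      + inner ℝ v (f x) * mvfderiv (𝓡 2) F x (f x) := by
  conv_lhs => rw [h.expand hx v]
  simp

/-- A 2-form on a surface is its value on the frame times a determinant. Directly: the derivatives
of the components of V and W cancel against those in [V, W] = ∇_V W - ∇_W V. -/
theorem curvForm_eq (h : OrthonormalFrameOn U e f) {x : M} (hx : x ∈ U)
    {V W : Π x : M, TangentSpace (𝓡 2) x} (hV : SmoothFieldAt V x) (hW : SmoothFieldAt W x) :
    curvForm e f V W x = -(inner ℝ (V x) (e x) * inner ℝ (W x) (f x)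
      - inner ℝ (V x) (f x) * inner ℝ (W x) (e x)) * frameCurvature e f x := by
  have ha := h.contMDiffAt_connForm_left hx
  have hb := h.contMDiffAt_connForm_right hx
  have key (W : Π x : M, TangentSpace (𝓡 2) x) (hW : SmoothFieldAt W x)
      (v : TangentSpace (𝓡 2) x) :
      mvfderiv (𝓡 2) (fun y ↦ connForm e f y (W y)) x v
        = (inner ℝ (W x) (e x) * mvfderiv (𝓡 2) (fun y ↦ connForm e f y (e y)) x v
            + mvfderiv (𝓡 2) (fun y ↦ (inner ℝ (W y) (e y) : ℝ)) x v * connForm e f x (e x))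
          + (inner ℝ (W x) (f x) * mvfderiv (𝓡 2) (fun y ↦ connForm e f y (f y)) x v
            + mvfderiv (𝓡 2) (fun y ↦ (inner ℝ (W y) (f y) : ℝ)) x v * connForm e f x (f x)) := by
    have hw0 := contMDiffAt_inner hW (h.smooth_left x hx)
    have hw1 := contMDiffAt_inner hW (h.smooth_right x hx)
    rw [← mvfderiv_mul_apply hw0 ha, ← mvfderiv_mul_apply hw1 hb,
      ← mvfderiv_add_apply (smoothAt_mul hw0 ha) (smoothAt_mul hw1 hb)]
    refine congr($(mvfderiv_congr ?_) v)
    filter_upwards [h.isOpen.mem_nhds hx] with y hy using h.connForm_apply hy _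
  have hV' := hV.mdifferentiableAt (by simp)
  have hW' := hW.mdifferentiableAt (by simp)
  rw [curvForm, key W hW, key V hV, ← leviCivita_sub_leviCivita hV' hW', h.connForm_apply hx (_ - _),
    inner_sub_left, inner_sub_left, h.inner_leviCivita_left hx hW', h.inner_leviCivita_left hx hV',
    h.inner_leviCivita_right hx hW', h.inner_leviCivita_right hx hV',
    h.connForm_apply hx (V x), h.connForm_apply hx (W x), frameCurvature,
    h.mvfderiv_apply_expand hx (fun y ↦ connForm e f y (e y)) (V x),
    h.mvfderiv_apply_expand hx (fun y ↦ connForm e f y (e y)) (W x),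
    h.mvfderiv_apply_expand hx (fun y ↦ connForm e f y (f y)) (V x),
    h.mvfderiv_apply_expand hx (fun y ↦ connForm e f y (f y)) (W x)]
  ring

/-- The square of this determinant is the denominator of the sectional curvature, so it must be
known to be nonzero. -/
theorem det_coordVec_ne_zero (h : OrthonormalFrameOn U e f) {x : M} (hx : x ∈ U) :
    (inner ℝ (coordVec x 0) (e x) * inner ℝ (coordVec x 1) (f x)
      - inner ℝ (coordVec x 0) (f x) * inner ℝ (coordVec x 1) (e x) : ℝ) ≠ 0 := by
  intro h0
  have hli (a b : ℝ) (hab : a • coordVec x 0 + b • coordVec x 1 = 0) : a = 0 ∧ b = 0 := by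
    have hab' : a • (EuclideanSpace.single 0 (1 : ℝ) : EuclideanSpace ℝ (Fin 2))
      + b • (EuclideanSpace.single 1 (1 : ℝ) : EuclideanSpace ℝ (Fin 2)) = 0 := hab
    exact ⟨by simpa using congr($hab' 0), by simpa using congr($hab' 1)⟩
  -- If the determinant vanishes, ⟨w, f⟩v - ⟨v, f⟩w has zero components in the frame, for v, w the
  -- coordinate vectors; independence gives ⟨v, f⟩ = 0. The same with e in place of f gives ⟨v, e⟩ =
  -- 0, so v = 0.
  have h1 := hli (inner ℝ (coordVec x 1) (f x)) (-inner ℝ (coordVec x 0) (f x)) (by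
    refine h.ext hx ?_ ?_ <;> simp only [inner_add_left, inner_smul_left, inner_zero_left] <;>
      simp <;> linarith)
  have h2 := hli (inner ℝ (coordVec x 1) (e x)) (-inner ℝ (coordVec x 0) (e x)) (by
    refine h.ext hx ?_ ?_ <;> simp only [inner_add_left, inner_smul_left, inner_zero_left] <;>
      simp <;> linarith)
  have h3 : coordVec x 0 = 0 := h.ext hx (by simpa using h2.2) (by simpa using h1.2)
  have := hli 1 0 (by simp [h3])
  simp at this

/-- The numerator contains the determinant twice, once from dω and once from the rotation of w
paired with v, and the denominator is its square. -/
theorem gaussianCurvature_eq (h : OrthonormalFrameOn U e f) {x : M} (hx : x ∈ U) :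
    gaussianCurvature x = frameCurvature e f x := by
  set v := coordVec x 0
  set w := coordVec x 1
  obtain ⟨s, hs, hsmooth⟩ := FiberBundle.exists_contMDiffOn_extend (k := ∞) (𝓡 2)
    (EuclideanSpace ℝ (Fin 2)) w
  obtain ⟨t, hts, ht, hxt⟩ := mem_nhds_iff.1 hs
  -- The extension of w is only known to be smooth near x, while the curvature differentiates it
  -- twice; the frame is therefore restricted to a neighbourhood where the extension is smooth.
  have h' := h.mono (h.isOpen.inter ht) (Set.inter_subset_left (t := t))
  have hW : ∀ y ∈ U ∩ t, SmoothFieldAt (FiberBundle.extend (EuclideanSpace ℝ (Fin 2)) w) y :=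
    fun y hy ↦ (hsmooth.mono hts).contMDiffAt (ht.mem_nhds hy.2)
  have hV : SmoothFieldAt (FiberBundle.extend (EuclideanSpace ℝ (Fin 2)) v) x :=
    FiberBundle.contMDiffAt_extend ..
  have hx' : x ∈ U ∩ t := ⟨hx, hxt⟩
  -- Lagrange's identity for the Gram determinant.
  have hD : inner ℝ v v * inner ℝ w w - inner ℝ v w ^ 2 = (inner ℝ v (e x) * inner ℝ w (f x)
      - inner ℝ v (f x) * inner ℝ w (e x) : ℝ) ^ 2 := by
    rw [h.inner_eq hx v v, h.inner_eq hx w w, h.inner_eq hx v w]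
    ring
  have hne := h.det_coordVec_ne_zero hx
  rw [gaussianCurvature, sectionalCurvature, hD, div_eq_iff (pow_ne_zero 2 hne),
    h.inner_eq hx (riemannCurvature _ _ _ x) _,
    h'.inner_riemannCurvature_left hx' hV (hW x hx') hW,
    h'.inner_riemannCurvature_right hx' hV (hW x hx') hW,
    h'.curvForm_eq hx' hV (hW x hx')]
  simp only [FiberBundle.extend_apply_self]
  ring

theorem contMDiffAt_gaussianCurvature (h : OrthonormalFrameOn U e f) {x : M} (hx : x ∈ U) :
    SmoothAt gaussianCurvature x := by
  have ha := h.contMDiffAt_connForm_left hx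
  have hb := h.contMDiffAt_connForm_right hx
  refine ((((contMDiffAt_mvfderiv_apply ha (h.smooth_right x hx)).sub
    (contMDiffAt_mvfderiv_apply hb (h.smooth_left x hx))).sub (ha.pow 2)).sub
      (hb.pow 2)).congr_of_eventuallyEq ?_
  filter_upwards [h.isOpen.mem_nhds hx] with y hy using h.gaussianCurvature_eq hy

end OrthonormalFrameOn

end Curvature

end RiemSurface

/-! ### Smoothness of integral curves. -/

namespace RiemSurface

/-- A solution of an autonomous differential equation with smooth right-hand side is smooth. -/
theorem contDiffOn_of_hasDerivAt_comp {E : Type*} [NormedAddCommGroup E] [NormedSpace ℝ E]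
    {F : E → E} {V : Set E} (hF : ContDiffOn ℝ ∞ F V) {c : ℝ → E} {J : Set ℝ} (hJ : IsOpen J)
    (hcV : Set.MapsTo c J V) (hc : ∀ t ∈ J, HasDerivAt c (F (c t)) t) : ContDiffOn ℝ ∞ c J := by
  refine contDiffOn_infty.2 fun n ↦ ?_
  induction n with
  | zero => exact contDiffOn_zero.2 fun t ht ↦ (hc t ht).continuousAt.continuousWithinAt
  | succ n ih =>
    push_cast
    -- Bootstrap: the derivative is F ∘ c, so it is as regular as c itself, and c gains one order.
    refine (contDiffOn_succ_iff_deriv_of_isOpen hJ).2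
      ⟨fun t ht ↦ (hc t ht).differentiableAt.differentiableWithinAt, by simp, ?_⟩
    exact ((hF.of_le (by exact_mod_cast le_top)).comp ih hcV).congr fun t ht ↦ (hc t ht).deriv

section IntegralCurve

variable {E : Type*} [NormedAddCommGroup E] [NormedSpace ℝ E] [FiniteDimensional ℝ E]
  {H : Type*} [TopologicalSpace H] {I : ModelWithCorners ℝ E H} [I.Boundaryless]
  {M : Type*} [TopologicalSpace M] [ChartedSpace H M] [IsManifold I ∞ M]

theorem mfderiv_extChartAt_apply_eq_chartField {p x : M} (hx : x ∈ (extChartAt I p).source)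
    (X : Π x : M, TangentSpace I x) :
    mfderiv I 𝓘(ℝ, E) (extChartAt I p) x (X x) = chartField p X (extChartAt I p x) := by
  have hy := (extChartAt I p).map_source hx
  have h1 := mfderiv_extChartAt_symm_chartField hy X
  have h2 := mfderiv_extChartAt_comp_mfderivWithin_extChartAt_symm (I := I) hy
  rw [I.range_eq_univ, mfderivWithin_univ] at h2
  have h3 := congr($h2 (chartField p X (extChartAt I p x) :))
  change mfderiv I 𝓘(ℝ, E) (extChartAt I p) _ (mfderiv 𝓘(ℝ, E) I (extChartAt I p).symm
    (extChartAt I p x) (chartField p X (extChartAt I p x) :)) = _ at h3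
  rw [h1, (extChartAt I p).left_inv hx] at h3
  exact h3

theorem hasDerivAt_comp_of_hasMFDerivAt {F : Type*} [NormedAddCommGroup F] [NormedSpace ℝ F]
    {f : M → F} {γ : ℝ → M} {t : ℝ} {v : TangentSpace I (γ t)} (hf : MDiffAt f (γ t))
    (hγ : HasMFDerivAt 𝓘(ℝ, ℝ) I γ t ((1 : ℝ →L[ℝ] ℝ).smulRight v)) :
    HasDerivAt (f ∘ γ) (mvfderiv I f (γ t) v) t := by
  have h : HasMFDerivAt 𝓘(ℝ, ℝ) 𝓘(ℝ, F) (f ∘ γ) t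
      ((mvfderiv I f (γ t)).comp ((1 : ℝ →L[ℝ] ℝ).smulRight v)) := hf.hasMFDerivAt.comp t hγ
  have h' : HasFDerivAt (f ∘ γ) ((mvfderiv I f (γ t)).comp ((1 : ℝ →L[ℝ] ℝ).smulRight v) :
      ℝ →L[ℝ] F) t := h.hasFDerivAt
  have h2 : ((mvfderiv I f (γ t)).comp ((1 : ℝ →L[ℝ] ℝ).smulRight v) : ℝ →L[ℝ] F) 1
      = mvfderiv I f (γ t) v :=
    congrArg (mvfderiv I f (γ t)) (one_smul ℝ v)
  exact h2 ▸ h'.hasDerivAt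

theorem hasDerivAt_extChartAt_comp {p : M} {γ : ℝ → M} {t : ℝ} {X : Π x : M, TangentSpace I x}
    (hp : γ t ∈ (extChartAt I p).source)
    (hγ : HasMFDerivAt 𝓘(ℝ, ℝ) I γ t ((1 : ℝ →L[ℝ] ℝ).smulRight (X (γ t)))) :
    HasDerivAt (extChartAt I p ∘ γ) (chartField p X (extChartAt I p (γ t))) t := by
  rw [← mfderiv_extChartAt_apply_eq_chartField hp]
  exact hasDerivAt_comp_of_hasMFDerivAt
    (mdifferentiableAt_extChartAt (I := I) (by rwa [extChartAt_source] at hp)) hγ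

/-- Integral curves of a smooth vector field are smooth. -/
theorem IsMIntegralCurveOn.contMDiffOn {γ : ℝ → M} {s : Set ℝ} (hs : IsOpen s)
    {X : Π x : M, TangentSpace I x} (hX : ∀ x, CMDiffAt ∞ (T% X) x)
    (hγ : IsMIntegralCurveOn γ X s) : ContMDiffOn 𝓘(ℝ, ℝ) I ∞ γ s := by
  intro t₀ ht₀
  set p := γ t₀
  have hγ' : ∀ t ∈ s, HasMFDerivAt 𝓘(ℝ, ℝ) I γ t ((1 : ℝ →L[ℝ] ℝ).smulRight (X (γ t))) :=
    fun t ht ↦ (hγ t ht).hasMFDerivAt (hs.mem_nhds ht)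
  have hcont : ContinuousOn γ s := fun t ht ↦ (hγ' t ht).continuousAt.continuousWithinAt
  set J := s ∩ γ ⁻¹' (extChartAt I p).source
  have hJ : IsOpen J := hcont.isOpen_inter_preimage hs (isOpen_extChartAt_source p)
  have ht₀J : t₀ ∈ J := ⟨ht₀, mem_extChartAt_source p⟩
  have hF : ContDiffOn ℝ ∞ (chartField p X) (extChartAt I p).target := fun y hy ↦
    (contDiffAt_chartField hy (hX _)).contDiffWithinAt
  have hc : ContDiffOn ℝ ∞ (extChartAt I p ∘ γ) J :=
    contDiffOn_of_hasDerivAt_comp hF hJ (fun t ht ↦ (extChartAt I p).map_source ht.2)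
      fun t ht ↦ hasDerivAt_extChartAt_comp ht.2 (hγ' t ht.1)
  have h1 := (contMDiffAt_extChartAt_symm_of_mem (I := I)
    ((extChartAt I p).map_source ht₀J.2)).comp t₀
      (hc.contDiffAt (hJ.mem_nhds ht₀J)).contMDiffAt
  refine ContMDiffAt.contMDiffWithinAt (h1.congr_of_eventuallyEq ?_)
  filter_upwards [hJ.mem_nhds ht₀J] with t ht
  exact ((extChartAt I p).left_inv ht.2).symm

end IntegralCurve

/-! ### The covariant acceleration of integral curves. -/

section Acceleration

variable {E : Type*} [NormedAddCommGroup E] [NormedSpace ℝ E] [FiniteDimensional ℝ E]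
  {H : Type*} [TopologicalSpace H] {I : ModelWithCorners ℝ E H} [I.Boundaryless]
  {M : Type*} [TopologicalSpace M] [ChartedSpace H M]
  [RiemannianBundle (fun x : M ↦ TangentSpace I x)]
  [IsManifold I ∞ M] [IsContMDiffRiemannianBundle I ∞ E (fun x : M ↦ TangentSpace I x)]

/-- The components of a vector field in the coordinate frame at `p`. -/
noncomputable def coordComp (p : M) (X : Π x : M, TangentSpace I x) (x : M) : E :=
  (trivializationAt E (TangentSpace I : M → Type _) p ⟨x, X x⟩).2

theorem mdifferentiableAt_coordComp {p : M} {X : Π x : M, TangentSpace I x}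
    (hX : MDiffAt (T% X) p) : MDiffAt (coordComp p X) p :=
  (mdifferentiableAt_section (F := E) (E := (TangentSpace I : M → Type _)) ..).1 hX

theorem eventually_mem_baseSet (p : M) :
    ∀ᶠ x in 𝓝 p, x ∈ (trivializationAt E (TangentSpace I : M → Type _) p).baseSet :=
  (trivializationAt E (TangentSpace I : M → Type _) p).open_baseSet.mem_nhds
    (FiberBundle.mem_baseSet_trivializationAt' p)

theorem coordComp_add {p : M} (X Y : Π x : M, TangentSpace I x) :
    coordComp p (X + Y) =ᶠ[𝓝 p] coordComp p X + coordComp p Y := by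
  filter_upwards [eventually_mem_baseSet (I := I) p] with x hx
  exact ((trivializationAt E (TangentSpace I : M → Type _) p).linear ℝ hx).map_add _ _

theorem coordComp_smul {p : M} (g : M → ℝ) (X : Π x : M, TangentSpace I x) :
    coordComp p (g • X) =ᶠ[𝓝 p] g • coordComp p X := by
  filter_upwards [eventually_mem_baseSet (I := I) p] with x hx
  exact ((trivializationAt E (TangentSpace I : M → Type _) p).linear ℝ hx).map_smul _ _

theorem coordComp_extend {p : M} (v : TangentSpace I p) :
    coordComp p (FiberBundle.extend E v) =ᶠ[𝓝 p]
      fun _ ↦ (trivializationAt E (TangentSpace I : M → Type _) p ⟨p, v⟩).2 := by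
  filter_upwards [eventually_mem_baseSet (I := I) p] with x hx
  have h := congrArg Prod.snd ((trivializationAt E (TangentSpace I : M → Type _) p).apply_mk_symm
    hx (trivializationAt E (TangentSpace I : M → Type _) p ⟨p, v⟩).2)
  exact h

/-- A covariant derivative is the derivative of the components plus a zeroth order term. -/
theorem leviCivita_eq_coordComp {p : M} {X : Π x : M, TangentSpace I x}
    (hX : MDiffAt (T% X) p) (v : TangentSpace I p) :
    leviCivita I M X p v
      = (trivializationAt E (TangentSpace I : M → Type _) p).symm p (mvfderiv I (coordComp p X) p v)
        + leviCivita I M (FiberBundle.extend E (X p)) p v := by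
  set T := trivializationAt E (TangentSpace I : M → Type _) p
  have hp : p ∈ T.baseSet := FiberBundle.mem_baseSet_trivializationAt' p
  have hcov := (leviCivita I M).isCovariantDerivativeOnUniv
  -- Two derivations satisfying the same Leibniz rule differ by a tensor. The difference thus
  -- depends only on X(p), and can be evaluated on the extension of X(p), whose components are
  -- locally constant.
  have ht : TensorialAt I E (fun X ↦ leviCivita I M X p v
      - T.symmL ℝ p (mvfderiv I (coordComp p X) p v)) p := by
    refine ⟨fun {g X} hg hX ↦ ?_, fun {X Y} hX hY ↦ ?_⟩
    · have h1 : leviCivita I M (g • X) p v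
          = g p • leviCivita I M X p v + mvfderiv I g p v • X p := by
        have := hcov.leibniz hX hg (Set.mem_univ p)
        exact congr($this v)
      have h2 : T.symmL ℝ p (coordComp p X p) = X p := by
        rw [T.symmL_apply hp]
        exact T.symm_apply_apply_mk hp (X p)
      rw [h1, mvfderiv_congr (coordComp_smul g X), mvfderiv_smul hg (mdifferentiableAt_coordComp hX)]
      simp [h2, smul_sub]
    · have h1 : leviCivita I M (X + Y) p v = leviCivita I M X p v + leviCivita I M Y p v := by
        have := hcov.add hX hY (Set.mem_univ p)
        exact congr($this v)
      rw [h1, mvfderiv_congr (coordComp_add X Y),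
        mvfderiv_add (mdifferentiableAt_coordComp hX) (mdifferentiableAt_coordComp hY)]
      simp
      abel
  have h := ht.pointwise hX (FiberBundle.mdifferentiableAt_extend I E (X p)) (by simp)
  rw [mvfderiv_congr (coordComp_extend (X p)), mvfderiv_const] at h
  simp only [_root_.zero_apply, map_zero, sub_zero] at h
  rw [← h, ← T.symmL_apply (R := ℝ) hp]
  abel

/-- `covDerivAlong` differentiates components along the curve. When the velocity is the restriction
of a field, the chain rule makes this the derivative of the field's components in the direction of
the velocity. -/
theorem acceleration_eq_leviCivita {γ : ℝ → M} {t : ℝ} {X : Π x : M, TangentSpace I x}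
    (hX : MDiffAt (T% X) (γ t)) (hγ : IsMIntegralCurveAt γ X t) :
    acceleration γ t = leviCivita I M X (γ t) (X (γ t)) := by
  have hvel : ∀ᶠ τ in 𝓝 t, velocity (I := I) γ τ = X (γ τ) := by
    filter_upwards [hγ] with τ hτ
    rw [velocity, hτ.mfderiv]
    exact one_smul ℝ _
  have hd : deriv (fun τ ↦
      (trivializationAt E (TangentSpace I : M → Type _) (γ t) ⟨γ τ, velocity γ τ⟩).2) t
      = mvfderiv I (coordComp (γ t) X) (γ t) (X (γ t)) := by
    have h1 : (fun τ ↦ (trivializationAt E (TangentSpace I : M → Type _) (γ t)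
        ⟨γ τ, velocity γ τ⟩).2) =ᶠ[𝓝 t] coordComp (γ t) X ∘ γ := by
      filter_upwards [hvel] with τ hτ
      simp only [coordComp, Function.comp_apply, hτ]
    rw [h1.deriv_eq]
    exact (hasDerivAt_comp_of_hasMFDerivAt (mdifferentiableAt_coordComp hX)
      hγ.hasMFDerivAt).deriv
  rw [leviCivita_eq_coordComp hX, acceleration, covDerivAlong, hd, hvel.self_of_nhds]

end Acceleration

end RiemSurface

namespace RiemSurface

theorem mvfderiv_eq_fderiv {E F : Type*} [NormedAddCommGroup E] [NormedSpace ℝ E]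
    [NormedAddCommGroup F] [NormedSpace ℝ F] (u : E → F) (y : E) :
    mvfderiv 𝓘(ℝ, E) u y = fderiv ℝ u y := by
  rw [mvfderiv, mfderiv_eq_fderiv]
  rfl

/-! ### A Poincaré lemma with respect to a frame. -/

section Primitive

/-- In a plane domain with a frame `V, W`, a function with prescribed derivatives `F, G` along the
frame exists locally as soon as the integrability condition holds. -/
theorem exists_primitive_of_frame {E : Type*} [NormedAddCommGroup E] [NormedSpace ℝ E]
    (hE : Module.finrank ℝ E = 2) {V W : E → E} {F G α β : E → ℝ} {O : Set E} (hO : IsOpen O)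
    (hV : ContDiffOn ℝ ∞ V O) (hW : ContDiffOn ℝ ∞ W O)
    (hF : ContDiffOn ℝ ∞ F O) (hG : ContDiffOn ℝ ∞ G O)
    (hind : ∀ y ∈ O, ∀ a b : ℝ, a • V y + b • W y = 0 → a = 0 ∧ b = 0)
    (hbr : ∀ y ∈ O, VectorField.lieBracket ℝ V W y = α y • V y + β y • W y)
    (hint : ∀ y ∈ O, fderiv ℝ G y (V y) - fderiv ℝ F y (W y) = α y * F y + β y * G y)
    {y₀ : E} (hy₀ : y₀ ∈ O) :
    ∃ O' ⊆ O, IsOpen O' ∧ y₀ ∈ O' ∧ ∃ u : E → ℝ, ContDiffOn ℝ ∞ u O' ∧ u y₀ = 0 ∧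
      ∀ y ∈ O', fderiv ℝ u y (V y) = F y ∧ fderiv ℝ u y (W y) = G y := by
  have : FiniteDimensional ℝ E := .of_finrank_pos (by omega)
  have : CompleteSpace E := FiniteDimensional.complete ℝ E
  let A : E → (ℝ × ℝ) →L[ℝ] E := fun y ↦
    (ContinuousLinearMap.fst ℝ ℝ ℝ).smulRight (V y) + (ContinuousLinearMap.snd ℝ ℝ ℝ).smulRight (W y)
  have hA (y : E) (q : ℝ × ℝ) : A y q = q.1 • V y + q.2 • W y := by simp [A]
  have hAinv : ∀ y ∈ O, ∃ e : (ℝ × ℝ) ≃L[ℝ] E, (e : (ℝ × ℝ) →L[ℝ] E) = A y := by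
    intro y hy
    have hinj : Function.Injective (A y : (ℝ × ℝ) →ₗ[ℝ] E) := by
      refine (injective_iff_map_eq_zero _).2 fun q hq ↦ ?_
      have hq' : q.1 • V y + q.2 • W y = 0 := by rw [← hA]; exact hq
      exact Prod.ext (hind y hy _ _ hq').1 (hind y hy _ _ hq').2
    refine ⟨((A y : (ℝ × ℝ) →ₗ[ℝ] E).linearEquivOfInjective hinj
      (by simp [hE])).toContinuousLinearEquiv, ?_⟩
    ext <;> rfl
  -- The one-form with θ(V) = F and θ(W) = G; the inverse is meaningful on O, where V, W is a basis.
  let θ : E → E →L[ℝ] ℝ := fun y ↦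
    (F y • ContinuousLinearMap.fst ℝ ℝ ℝ + G y • ContinuousLinearMap.snd ℝ ℝ ℝ).comp (A y).inverse
  have hθA : ∀ y ∈ O, ∀ q : ℝ × ℝ, θ y (q.1 • V y + q.2 • W y) = F y * q.1 + G y * q.2 := by
    intro y hy q
    obtain ⟨e, he⟩ := hAinv y hy
    rw [← hA]
    simp only [θ, ← he, ContinuousLinearMap.inverse_equiv]
    simp
  have hθV : ∀ y ∈ O, θ y (V y) = F y := fun y hy ↦ by simpa using hθA y hy (1, 0)
  have hθW : ∀ y ∈ O, θ y (W y) = G y := fun y hy ↦ by simpa using hθA y hy (0, 1)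
  have hsurj : ∀ y ∈ O, ∀ v : E, ∃ a b : ℝ, v = a • V y + b • W y := by
    intro y hy v
    obtain ⟨e, he⟩ := hAinv y hy
    refine ⟨(e.symm v).1, (e.symm v).2, ?_⟩
    rw [← hA, ← he]
    simp
  have hθs : ContDiffOn ℝ ∞ θ O := by
    intro y hy
    have hVy := hV.contDiffAt (hO.mem_nhds hy)
    have hWy := hW.contDiffAt (hO.mem_nhds hy)
    have hFy := hF.contDiffAt (hO.mem_nhds hy)
    have hGy := hG.contDiffAt (hO.mem_nhds hy)
    obtain ⟨e, he⟩ := hAinv y hy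
    have hAy : ContDiffAt ℝ ∞ A y :=
      (contDiffAt_const.smulRight hVy).add (contDiffAt_const.smulRight hWy)
    have hinv : ContDiffAt ℝ ∞ (fun y ↦ (A y).inverse) y :=
      ContDiffAt.comp (g := ContinuousLinearMap.inverse) y
        (he ▸ contDiffAt_map_inverse (𝕜 := ℝ) e) hAy
    exact (((hFy.smul contDiffAt_const).add (hGy.smul contDiffAt_const)).clm_comp
      hinv).contDiffWithinAt
  -- θ is closed: on the pair (V, W) this is the integrability condition, after differentiating F =
  -- θ(V) and G = θ(W) and using the bracket relation; bilinearity does the rest.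
  have hsymm : ∀ y ∈ O, ∀ v w : E, fderiv ℝ θ y v w = fderiv ℝ θ y w v := by
    intro y hy
    have hm := hO.mem_nhds hy
    have hθ' := (hθs.contDiffAt hm).differentiableAt (by simp)
    have hV' := (hV.contDiffAt hm).differentiableAt (by simp)
    have hW' := (hW.contDiffAt hm).differentiableAt (by simp)
    have h1 (v : E) : fderiv ℝ F y v = fderiv ℝ θ y v (V y) + θ y (fderiv ℝ V y v) := by
      have : F =ᶠ[𝓝 y] fun z ↦ θ z (V z) :=
        Filter.eventually_of_mem hm fun z hz ↦ (hθV z hz).symm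
      rw [this.fderiv_eq, fderiv_clm_apply hθ' hV']
      simp [add_comm]
    have h2 (v : E) : fderiv ℝ G y v = fderiv ℝ θ y v (W y) + θ y (fderiv ℝ W y v) := by
      have : G =ᶠ[𝓝 y] fun z ↦ θ z (W z) :=
        Filter.eventually_of_mem hm fun z hz ↦ (hθW z hz).symm
      rw [this.fderiv_eq, fderiv_clm_apply hθ' hW']
      simp [add_comm]
    have h3 : fderiv ℝ θ y (V y) (W y) = fderiv ℝ θ y (W y) (V y) := by
      have hb := congrArg (θ y) (hbr y hy)
      rw [VectorField.lieBracket, map_sub, hθA y hy (α y, β y)] at hb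
      have := hint y hy
      rw [h1, h2] at this
      simp only at hb
      linarith
    intro v w
    obtain ⟨a, b, rfl⟩ := hsurj y hy v
    obtain ⟨a', b', rfl⟩ := hsurj y hy w
    simp only [map_add, map_smul, add_apply, smul_apply, smul_eq_mul, h3]
    ring
  -- A ball is convex, so the closed form is exact on it; subtracting a constant makes the primitive
  -- vanish at y₀.
  obtain ⟨r, hr, hrO⟩ := Metric.isOpen_iff.1 hO y₀ hy₀
  obtain ⟨u, hu⟩ := (convex_ball y₀ r).exists_forall_hasFDerivAt_of_fderiv_symmetric
    Metric.isOpen_ball ((hθs.mono hrO).differentiableOn (by simp)) fun y hy ↦ hsymm y (hrO hy)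
  have hu' : ∀ y ∈ Metric.ball y₀ r, HasFDerivAt (fun y ↦ u y - u y₀) (θ y) y :=
    fun y hy ↦ (hu y hy).sub_const _
  refine ⟨Metric.ball y₀ r, hrO, Metric.isOpen_ball, Metric.mem_ball_self hr,
    fun y ↦ u y - u y₀, ?_, by simp, fun y hy ↦ ?_⟩
  · refine (contDiffOn_infty_iff_fderiv_of_isOpen Metric.isOpen_ball).2
      ⟨fun y hy ↦ (hu' y hy).differentiableAt.differentiableWithinAt, ?_⟩
    exact (hθs.mono hrO).congr fun y hy ↦ (hu' y hy).fderiv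
  · rw [(hu' y hy).fderiv]
    exact ⟨hθV y (hrO hy), hθW y (hrO hy)⟩

end Primitive

section SurfacePrimitive

variable {M : Type*} [TopologicalSpace M] [ChartedSpace (EuclideanSpace ℝ (Fin 2)) M]
  [IsManifold (𝓡 2) ∞ M] [RiemannianBundle (fun x : M ↦ TangentSpace (𝓡 2) x)]
  [IsContMDiffRiemannianBundle (𝓡 2) ∞ (EuclideanSpace ℝ (Fin 2))
      (fun x : M ↦ TangentSpace (𝓡 2) x)]
  {U : Set M} {e f : Π x : M, TangentSpace (𝓡 2) x}

/-- A function with prescribed derivatives along an orthonormal frame exists locally as soon as the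
integrability condition holds. -/
theorem OrthonormalFrameOn.exists_primitive (h : OrthonormalFrameOn U e f) {F G : M → ℝ}
    (hF : ∀ x ∈ U, SmoothAt F x) (hG : ∀ x ∈ U, SmoothAt G x)
    (hint : ∀ x ∈ U, mvfderiv (𝓡 2) G x (e x) - mvfderiv (𝓡 2) F x (f x)
      = -connForm e f x (e x) * F x - connForm e f x (f x) * G x) {p : M} (hp : p ∈ U) :
    ∃ U' ⊆ U, IsOpen U' ∧ p ∈ U' ∧ ∃ u : M → ℝ, (∀ x ∈ U', SmoothAt u x) ∧ u p = 0 ∧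
      ∀ x ∈ U', mvfderiv (𝓡 2) u x (e x) = F x ∧ mvfderiv (𝓡 2) u x (f x) = G x := by
  set φ := extChartAt (𝓡 2) p
  set O := φ.target ∩ φ.symm ⁻¹' U
  have hO : IsOpen O :=
    (continuousOn_extChartAt_symm p).isOpen_inter_preimage (isOpen_extChartAt_target p) h.isOpen
  have hO1 {y} (hy : y ∈ O) : y ∈ φ.target := hy.1
  have hO2 {y} (hy : y ∈ O) : φ.symm y ∈ U := hy.2
  have hpO : φ p ∈ O := ⟨mem_extChartAt_target p, by simpa [φ] using hp⟩
  have hind : ∀ y ∈ O, ∀ a b : ℝ, a • chartField p e y + b • chartField p f y = 0 →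
      a = 0 ∧ b = 0 := by
    intro y hy a b hab
    let D : EuclideanSpace ℝ (Fin 2) →L[ℝ] TangentSpace (𝓡 2) (φ.symm y) :=
      mfderiv 𝓘(ℝ, EuclideanSpace ℝ (Fin 2)) (𝓡 2) φ.symm y
    have hDe : D (chartField p e y) = e (φ.symm y) := mfderiv_extChartAt_symm_chartField (hO1 hy) e
    have hDf : D (chartField p f y) = f (φ.symm y) := mfderiv_extChartAt_symm_chartField (hO1 hy) f
    have h2 : a • e (φ.symm y) + b • f (φ.symm y) = 0 := by
      rw [← hDe, ← hDf, ← map_smul, ← map_smul, ← map_add, hab, map_zero]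
    have h3 := congrArg (fun v ↦ (inner ℝ v (e (φ.symm y)) : ℝ)) h2
    have h4 := congrArg (fun v ↦ (inner ℝ v (f (φ.symm y)) : ℝ)) h2
    simp only [inner_add_left, inner_smul_left, h.inner_left _ (hO2 hy), h.inner_right _ (hO2 hy),
      h.inner_left_right _ (hO2 hy), real_inner_comm (e (φ.symm y)) (f (φ.symm y)),
      inner_zero_left] at h3 h4
    exact ⟨by simpa using h3, by simpa using h4⟩
  have hbr : ∀ y ∈ O, VectorField.lieBracket ℝ (chartField p e) (chartField p f) y
      = -connForm e f (φ.symm y) (e (φ.symm y)) • chartField p e y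
        + -connForm e f (φ.symm y) (f (φ.symm y)) • chartField p f y := by
    intro y hy
    rw [lieBracket_chartField (hO1 hy) (h.mdiffAt_left (hO2 hy)) (h.mdiffAt_right (hO2 hy))]
    change (mfderiv 𝓘(ℝ, EuclideanSpace ℝ (Fin 2)) (𝓡 2) φ.symm y).inverse
      (VectorField.mlieBracket (𝓡 2) e f (φ.symm y)) = _
    rw [h.mlieBracket_eq (hO2 hy), sub_eq_add_neg, ← neg_smul, map_add, map_smul, map_smul]
    rfl
  have hint' : ∀ y ∈ O, fderiv ℝ (G ∘ φ.symm) y (chartField p e y)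
        - fderiv ℝ (F ∘ φ.symm) y (chartField p f y)
      = -connForm e f (φ.symm y) (e (φ.symm y)) * (F ∘ φ.symm) y
        + -connForm e f (φ.symm y) (f (φ.symm y)) * (G ∘ φ.symm) y := by
    intro y hy
    rw [fderiv_comp_extChartAt_symm_chartField (hO1 hy) e ((hG _ (hO2 hy)).mdifferentiableAt (by simp)),
      fderiv_comp_extChartAt_symm_chartField (hO1 hy) f ((hF _ (hO2 hy)).mdifferentiableAt (by simp)),
      hint _ (hO2 hy)]
    simp only [Function.comp_apply]
    ring
  obtain ⟨O', hO', hO'o, hpO', u, hu, hup, hud⟩ := exists_primitive_of_frame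
    (V := chartField p e) (W := chartField p f) (F := F ∘ φ.symm) (G := G ∘ φ.symm)
    (α := fun y ↦ -connForm e f (φ.symm y) (e (φ.symm y)))
    (β := fun y ↦ -connForm e f (φ.symm y) (f (φ.symm y)))
    (finrank_euclideanSpace_fin (𝕜 := ℝ) (n := 2)) hO
    (fun y hy ↦ (contDiffAt_chartField (hO1 hy) (h.smooth_left _ (hO2 hy))).contDiffWithinAt)
    (fun y hy ↦ (contDiffAt_chartField (hO1 hy) (h.smooth_right _ (hO2 hy))).contDiffWithinAt)
    (fun y hy ↦ (contDiffAt_comp_extChartAt_symm (hO1 hy) (hF _ (hO2 hy))).contDiffWithinAt)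
    (fun y hy ↦ (contDiffAt_comp_extChartAt_symm (hO1 hy) (hG _ (hO2 hy))).contDiffWithinAt)
    hind hbr hint' hpO
  refine ⟨φ.source ∩ φ ⁻¹' O', ?_, ?_, ⟨mem_extChartAt_source p, hpO'⟩, u ∘ φ, ?_, hup, ?_⟩
  · rintro x ⟨hx, hx'⟩
    simpa [φ.left_inv hx] using hO2 (hO' hx')
  · exact (continuousOn_extChartAt p).isOpen_inter_preimage (isOpen_extChartAt_source p) hO'o
  · rintro x ⟨hx, hx'⟩
    exact (hu.contDiffAt (hO'o.mem_nhds hx')).contMDiffAt.comp x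
      (contMDiffAt_extChartAt' (by rwa [extChartAt_source] at hx))
  · rintro x ⟨hx, hx'⟩
    have key (X : Π x : M, TangentSpace (𝓡 2) x) :
        mvfderiv (𝓡 2) (u ∘ φ) x (X x) = fderiv ℝ u (φ x) (chartField p X (φ x)) := by
      have h1 : MDifferentiableAt 𝓘(ℝ, EuclideanSpace ℝ (Fin 2)) 𝓘(ℝ, ℝ) u (φ x) :=
        (hu.contDiffAt (hO'o.mem_nhds hx')).contMDiffAt.mdifferentiableAt (by simp)
      have h2 := mvfderiv_comp_apply (I' := 𝓡 2) x h1
        (mdifferentiableAt_extChartAt (I := 𝓡 2) (x := p) (by rwa [extChartAt_source] at hx))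
        (X x)
      rw [mfderiv_extChartAt_apply_eq_chartField hx, mvfderiv_eq_fderiv] at h2
      exact h2
    have := hud _ hx'
    rw [key, key, this.1, this.2]
    simp [φ.left_inv hx]

end SurfacePrimitive

end RiemSurface

namespace RiemSurface

/-! ### Local coordinates from two functions with independent differentials. -/

section Coordinates

variable {M : Type*} [TopologicalSpace M] [ChartedSpace (EuclideanSpace ℝ (Fin 2)) M]
  [IsManifold (𝓡 2) ∞ M]

theorem exists_square_subset {T : Set (ℝ × ℝ)} (hT : IsOpen T) (h0 : (0, 0) ∈ T) :
    ∃ ε > 0, Set.Ioo (-ε) ε ×ˢ Set.Ioo (-ε) ε ⊆ T := by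
  obtain ⟨ε, hε, h⟩ := Metric.isOpen_iff.1 hT _ h0
  refine ⟨ε, hε, ?_⟩
  rw [← ball_prod_same, Real.ball_eq_Ioo] at h
  simpa using h

/-- Two functions with independent differentials are local coordinates on a surface. -/
theorem exists_coordinates {p : M} {U : Set M} (hU : IsOpen U) (hp : p ∈ U) {u s : M → ℝ}
    (hu : ∀ x ∈ U, ContMDiffAt (𝓡 2) 𝓘(ℝ, ℝ) ∞ u x)
    (hs : ∀ x ∈ U, ContMDiffAt (𝓡 2) 𝓘(ℝ, ℝ) ∞ s x) (hup : u p = 0) (hsp : s p = 0)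
    (hinj : ∀ x ∈ U, ∀ v : TangentSpace (𝓡 2) x, mvfderiv (𝓡 2) u x v = 0 →
      mvfderiv (𝓡 2) s x v = 0 → v = 0) :
    ∃ (ε : ℝ) (X : OpenPartialHomeomorph (ℝ × ℝ) M), 0 < ε ∧
      X.source = Set.Ioo (-ε) ε ×ˢ Set.Ioo (-ε) ε ∧ X.target ⊆ U ∧
      ContMDiffOn 𝓘(ℝ, ℝ × ℝ) (𝓡 2) ∞ X X.source ∧
      ContMDiffOn (𝓡 2) 𝓘(ℝ, ℝ × ℝ) ∞ X.symm X.target ∧ X (0, 0) = p ∧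
      ∀ q ∈ X.source, u (X q) = q.1 ∧ s (X q) = q.2 := by
  set φ := extChartAt (𝓡 2) p
  set O := φ.target ∩ φ.symm ⁻¹' U
  have hO : IsOpen O :=
    (continuousOn_extChartAt_symm p).isOpen_inter_preimage (isOpen_extChartAt_target p) hU
  have hpO : φ p ∈ O := ⟨mem_extChartAt_target p, by simpa [φ] using hp⟩
  let G : EuclideanSpace ℝ (Fin 2) → ℝ × ℝ := fun y ↦ ((u ∘ φ.symm) y, (s ∘ φ.symm) y)
  have hGs : ∀ y ∈ O, ContDiffAt ℝ ∞ G y := fun y hy ↦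
    (contDiffAt_comp_extChartAt_symm hy.1 (hu _ hy.2)).prodMk
      (contDiffAt_comp_extChartAt_symm hy.1 (hs _ hy.2))
  -- Invertibility is shown on all of O and not only at the centre, because smoothness of the
  -- inverse map is needed at every point of the image.
  have hG' : ∀ y ∈ O, ∃ e : EuclideanSpace ℝ (Fin 2) ≃L[ℝ] ℝ × ℝ,
      HasFDerivAt G (e : EuclideanSpace ℝ (Fin 2) →L[ℝ] ℝ × ℝ) y := by
    intro y hy
    let D : EuclideanSpace ℝ (Fin 2) →L[ℝ] TangentSpace (𝓡 2) (φ.symm y) :=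
      mfderiv 𝓘(ℝ, EuclideanSpace ℝ (Fin 2)) (𝓡 2) φ.symm y
    have hD : Function.Injective D :=
      (isInvertible_mfderiv_extChartAt_symm (I := 𝓡 2) hy.1).injective
    have hcomp (g : M → ℝ) (hg : ContMDiffAt (𝓡 2) 𝓘(ℝ, ℝ) ∞ g (φ.symm y))
        (w : EuclideanSpace ℝ (Fin 2)) :
        fderiv ℝ (g ∘ φ.symm) y w = mvfderiv (𝓡 2) g (φ.symm y) (D w) := by
      have h := mvfderiv_comp_apply (I := 𝓡 2) (I' := 𝓘(ℝ, EuclideanSpace ℝ (Fin 2))) y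
        (hg.mdifferentiableAt (by simp))
        ((contMDiffAt_extChartAt_symm_of_mem hy.1).mdifferentiableAt (by simp)) w
      rw [mvfderiv_eq_fderiv] at h
      exact h
    have hd := ((contDiffAt_comp_extChartAt_symm hy.1 (hu _ hy.2)).differentiableAt
      (by simp)).hasFDerivAt.prodMk ((contDiffAt_comp_extChartAt_symm hy.1
        (hs _ hy.2)).differentiableAt (by simp)).hasFDerivAt
    set L := (fderiv ℝ (u ∘ φ.symm) y).prod (fderiv ℝ (s ∘ φ.symm) y)
    have hL : Function.Injective (L : EuclideanSpace ℝ (Fin 2) →ₗ[ℝ] ℝ × ℝ) := by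
      refine (injective_iff_map_eq_zero _).2 fun w hw ↦ hD ?_
      rw [map_zero]
      refine hinj _ hy.2 _ ?_ ?_
      · rw [← hcomp u (hu _ hy.2)]
        exact congrArg Prod.fst hw
      · rw [← hcomp s (hs _ hy.2)]
        exact congrArg Prod.snd hw
    let e := ((L : EuclideanSpace ℝ (Fin 2) →ₗ[ℝ] ℝ × ℝ).linearEquivOfInjective hL
      (by simp)).toContinuousLinearEquiv
    have he : (e : EuclideanSpace ℝ (Fin 2) →L[ℝ] ℝ × ℝ) = L :=
      ContinuousLinearMap.ext fun _ ↦ rfl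
    exact ⟨e, he ▸ hd⟩
  obtain ⟨e₀, he₀⟩ := hG' _ hpO
  let h := ((hGs _ hpO).toOpenPartialHomeomorph G he₀ (by simp)).restrOpen O hO
  have hhG (y) : h y = G y := rfl
  have hph : φ p ∈ h.source :=
    ⟨(hGs _ hpO).mem_toOpenPartialHomeomorph_source he₀ (by simp), hpO⟩
  have hhO : h.source ⊆ O := fun y hy ↦ hy.2
  let Y : OpenPartialHomeomorph M (ℝ × ℝ) := (chartAt (EuclideanSpace ℝ (Fin 2)) p).trans h
  have hYφ (x) (hx : x ∈ Y.source) : x ∈ φ.source ∧ φ x ∈ h.source := by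
    have := hx
    simp only [Y, OpenPartialHomeomorph.trans_source] at this
    exact ⟨by simpa [φ] using this.1, by simpa [φ] using this.2⟩
  have hYU : Y.source ⊆ U := fun x hx ↦ by
    have := (hhO (hYφ x hx).2).2
    rwa [Set.mem_preimage, φ.left_inv (hYφ x hx).1] at this
  have hY (x) (hx : x ∈ Y.source) : Y x = (u x, s x) := by
    have h1 : Y x = G (φ x) := rfl
    rw [h1]
    simp only [G, Function.comp_apply, φ.left_inv (hYφ x hx).1]
  have hpY : p ∈ Y.source := by
    simp only [Y, OpenPartialHomeomorph.trans_source]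
    exact ⟨mem_chart_source _ p, hph⟩
  have h0 : ((0 : ℝ), (0 : ℝ)) ∈ Y.target := by
    have := Y.map_source hpY
    rwa [hY p hpY, hup, hsp] at this
  obtain ⟨ε, hε, hsq⟩ := exists_square_subset Y.open_target h0
  have hsqo : IsOpen (Set.Ioo (-ε) ε ×ˢ Set.Ioo (-ε) ε) := isOpen_Ioo.prod isOpen_Ioo
  let X := Y.symm.restrOpen (Set.Ioo (-ε) ε ×ˢ Set.Ioo (-ε) ε) hsqo
  have hXs : X.source = Set.Ioo (-ε) ε ×ˢ Set.Ioo (-ε) ε := by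
    simp only [X, OpenPartialHomeomorph.restrOpen_source, OpenPartialHomeomorph.symm_source]
    exact Set.inter_eq_right.2 hsq
  have hXY (q) (hq : q ∈ X.source) : X q ∈ Y.source := Y.map_target (hsq (hXs ▸ hq))
  have hXt : X.target ⊆ Y.source := fun x hx ↦ by
    have := hXY _ (X.map_target hx)
    rwa [X.right_inv hx] at this
  refine ⟨ε, X, hε, hXs, hXt.trans hYU, fun q hq ↦ ?_, fun x hx ↦ ?_, ?_, fun q hq ↦ ?_⟩
  · have hqY : q ∈ Y.target := hsq (hXs ▸ hq)
    have hqh : q ∈ h.target := by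
      simp only [Y, OpenPartialHomeomorph.trans_target] at hqY
      exact hqY.1
    have hqO : h.symm q ∈ O := hhO (h.map_target hqh)
    obtain ⟨e, he⟩ := hG' _ hqO
    have h1 : ContDiffAt ℝ ∞ h.symm q := h.contDiffAt_symm hqh he (hGs _ hqO)
    have h2 : ContMDiffAt 𝓘(ℝ, ℝ × ℝ) (𝓡 2) ∞ (φ.symm ∘ h.symm) q :=
      (contMDiffAt_extChartAt_symm_of_mem (I := 𝓡 2) hqO.1).comp q h1.contMDiffAt
    exact h2.contMDiffWithinAt
  · have hxY := hXt hx
    have h1 : ContMDiffAt (𝓡 2) 𝓘(ℝ, ℝ × ℝ) ∞ (fun x ↦ (u x, s x)) x :=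
      (hu x (hYU hxY)).prodMk_space (hs x (hYU hxY))
    refine (h1.congr_of_eventuallyEq ?_).contMDiffWithinAt
    filter_upwards [Y.open_source.mem_nhds hxY] with z hz using hY z hz
  · have := Y.left_inv hpY
    rwa [hY p hpY, hup, hsp] at this
  · have h1 : (u (X q), s (X q)) = q := by
      rw [← hY _ (hXY q hq)]
      exact Y.right_inv (hsq (hXs ▸ hq))
    exact ⟨congrArg Prod.fst h1, congrArg Prod.snd h1⟩

end Coordinates

end RiemSurface

namespace RiemSurface

/-! ### Orientation and the unit normal. -/

section Orientation

variable {M : Type*} [TopologicalSpace M] [ChartedSpace (EuclideanSpace ℝ (Fin 2)) M]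
  [IsManifold (𝓡 2) ∞ M]

/-- The sign of a determinant decides whether a change of basis preserves the orientation. -/
theorem SurfaceOrientation.IsPositive.iff_det_pos {o : SurfaceOrientation M} {x : M}
    {v w : TangentSpace (𝓡 2) x} (h : o.IsPositive v w) (a b c d : ℝ) :
    o.IsPositive (a • v + b • w) (c • v + d • w) ↔ 0 < a * d - b * c := by
  obtain ⟨B, rfl, rfl, hB⟩ := h
  have hdet : B.det ![a • B 0 + b • B 1, c • B 0 + d • B 1] = a * d - b * c := by
    rw [Module.Basis.det_apply, Matrix.det_fin_two]
    simp [Module.Basis.toMatrix_apply]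
    ring
  constructor
  · rintro ⟨B', h0, h1, hB'⟩
    have : (B' : Fin 2 → TangentSpace (𝓡 2) x)
        = ![a • B 0 + b • B 1, c • B 0 + d • B 1] := by
      funext i
      fin_cases i <;> simp [h0, h1]
    have h2 := (B.orientation_eq_iff_det_pos B').1 (hB.trans hB'.symm)
    rwa [this, hdet] at h2
  · intro hpos
    have hu : IsUnit (B.det ![a • B 0 + b • B 1, c • B 0 + d • B 1]) := by
      rw [hdet]
      exact hpos.ne'.isUnit
    obtain ⟨hli, hsp⟩ := (B.is_basis_iff_det).2 hu
    refine ⟨Module.Basis.mk hli hsp.ge, by simp, by simp, ?_⟩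
    rw [← hB, eq_comm, B.orientation_eq_iff_det_pos, Module.Basis.coe_mk, hdet]
    exact hpos

variable [RiemannianBundle (fun x : M ↦ TangentSpace (𝓡 2) x)]

theorem SurfaceOrientation.IsPositiveOrthonormal.right_unique {o : SurfaceOrientation M} {x : M}
    {v w n : TangentSpace (𝓡 2) x} (h : o.IsPositiveOrthonormal v w)
    (h' : o.IsPositiveOrthonormal w n) : n = -v := by
  obtain ⟨h1, h2, h3, h4⟩ := h
  obtain ⟨h1', h2', h3', h4'⟩ := h'
  have hn := eq_inner_smul_add_inner_smul (finrank_tangentSpace x) h1 h2 h3 n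
  rw [real_inner_comm, real_inner_comm w n, h2', real_inner_comm] at hn
  set a : ℝ := inner ℝ n v
  have ha : n = a • v := by simpa using hn
  rw [ha, inner_smul_left, inner_smul_right, h1] at h3'
  have hsq : a * a = 1 := by simpa using h3'
  -- Here n = a v with a² = 1, and the passage from (v, w) to (w, a v) has determinant -a, so a < 0.
  have h5 := (h4.iff_det_pos 0 1 a 0).1 (by simpa [ha] using h4')
  have : a = -1 := by nlinarith
  rw [ha, this, neg_one_smul]

end Orientation

/-! ### Gradients and completion of a unit field to a frame. -/

section Gradient

variable {M : Type*} [TopologicalSpace M] [ChartedSpace (EuclideanSpace ℝ (Fin 2)) M]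
  [IsManifold (𝓡 2) ∞ M] [RiemannianBundle (fun x : M ↦ TangentSpace (𝓡 2) x)]

theorem inner_mgradient (F : M → ℝ) (x : M) (v : TangentSpace (𝓡 2) x) :
    inner ℝ (mgradient (I := 𝓡 2) F x) v = mvfderiv (𝓡 2) F x v := by
  simp [mgradient]

variable [IsContMDiffRiemannianBundle (𝓡 2) ∞ (EuclideanSpace ℝ (Fin 2))
      (fun x : M ↦ TangentSpace (𝓡 2) x)]

theorem contMDiffAt_norm {x : M} {Z : Π x : M, TangentSpace (𝓡 2) x} (hZ : SmoothFieldAt Z x)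
    (h0 : Z x ≠ 0) : SmoothAt (fun y ↦ ‖Z y‖) x := by
  have h1 : SmoothAt (fun y ↦ Real.sqrt (inner ℝ (Z y) (Z y))) x :=
    (Real.contDiffAt_sqrt (n := ∞) (inner_self_ne_zero.2 h0)).contMDiffAt.comp x
      (contMDiffAt_inner hZ hZ)
  refine h1.congr_of_eventuallyEq (.of_forall fun y ↦ ?_)
  exact norm_eq_sqrt_real_inner _

theorem contMDiffAt_normalize {x : M} {Z : Π x : M, TangentSpace (𝓡 2) x} (hZ : SmoothFieldAt Z x)
    (h0 : Z x ≠ 0) : SmoothFieldAt (fun y ↦ ‖Z y‖⁻¹ • Z y) x :=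
  ((contMDiffAt_norm hZ h0).inv₀ (norm_ne_zero_iff.2 h0)).smul_section hZ

/-- A smooth unit field is locally a member of a smooth orthonormal frame. -/
theorem exists_orthonormalFrameOn {f : Π x : M, TangentSpace (𝓡 2) x} (hf : ∀ x, SmoothFieldAt f x)
    (hf1 : ∀ x, inner ℝ (f x) (f x) = (1 : ℝ)) {p : M} {w : TangentSpace (𝓡 2) p} (hw : w ≠ 0)
    (hwf : inner ℝ w (f p) = (0 : ℝ)) :
    ∃ U e, p ∈ U ∧ OrthonormalFrameOn U e f := by
  obtain ⟨t, ht, hts⟩ := FiberBundle.exists_contMDiffOn_extend (k := ∞) (𝓡 2)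
    (EuclideanSpace ℝ (Fin 2)) w
  obtain ⟨V, hVt, hV, hpV⟩ := mem_nhds_iff.1 ht
  set S : Π x : M, TangentSpace (𝓡 2) x := FiberBundle.extend (EuclideanSpace ℝ (Fin 2)) w
  have hS : ∀ y ∈ V, SmoothFieldAt S y := fun y hy ↦
    (hts.mono hVt).contMDiffAt (hV.mem_nhds hy)
  -- One Gram–Schmidt step: an extension of w is made orthogonal to f, without changing its value at
  -- p, and normalized where it is nonzero.
  let Z : Π x : M, TangentSpace (𝓡 2) x := fun y ↦ S y - (inner ℝ (S y) (f y) : ℝ) • f y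
  have hZ : ∀ y ∈ V, SmoothFieldAt Z y := fun y hy ↦
    (hS y hy).sub_section ((contMDiffAt_inner (hS y hy) (hf y)).smul_section (hf y))
  have hZf (y) : inner ℝ (Z y) (f y) = (0 : ℝ) := by
    simp only [Z, inner_sub_left, inner_smul_left, hf1]
    simp
  have hZp : Z p = w := by
    have : S p = w := FiberBundle.extend_apply_self ..
    simp only [Z, this, hwf, zero_smul, sub_zero]
  have hcont : ContinuousOn (fun y ↦ (inner ℝ (Z y) (Z y) : ℝ)) V := fun y hy ↦
    (contMDiffAt_inner (hZ y hy) (hZ y hy)).continuousAt.continuousWithinAt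
  have hne (y) (hy : y ∈ V ∩ (fun y ↦ (inner ℝ (Z y) (Z y) : ℝ)) ⁻¹' {0}ᶜ) : Z y ≠ 0 :=
    fun h ↦ hy.2 (by simp [h])
  refine ⟨V ∩ (fun y ↦ (inner ℝ (Z y) (Z y) : ℝ)) ⁻¹' {0}ᶜ, fun y ↦ ‖Z y‖⁻¹ • Z y,
    ⟨hpV, ?_⟩, ?_⟩
  · rw [Set.mem_preimage, hZp]
    exact inner_self_ne_zero.2 hw
  · refine ⟨hcont.isOpen_inter_preimage hV isOpen_compl_singleton,
      fun y hy ↦ contMDiffAt_normalize (hZ y hy.1) (hne y hy), fun y _ ↦ hf y, fun y hy ↦ ?_,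
      fun y hy ↦ ?_, fun y _ ↦ hf1 y⟩
    · have := norm_ne_zero_iff.2 (hne y hy)
      rw [inner_smul_left, inner_smul_right, real_inner_self_eq_norm_sq]
      simp only [conj_trivial]
      field_simp
    · rw [inner_smul_left, hZf, mul_zero]

end Gradient

/-! ### Integral curves on a surface. -/

section Curve

variable {M : Type*} [TopologicalSpace M]
  [ChartedSpace (EuclideanSpace ℝ (Fin 2)) M]
  [IsManifold (𝓡 2) ∞ M]

theorem exists_isMIntegralCurveOn_Ioo {f : Π x : M, TangentSpace (𝓡 2) x}
    (hf : ∀ x, SmoothFieldAt f x) (p : M) :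
    ∃ ε > 0, ∃ γ : ℝ → M, γ 0 = p ∧ IsMIntegralCurveOn γ f (Set.Ioo (-ε) ε) := by
  have : IsManifold (𝓡 2) 1 M := .of_le (n := ∞) (by simp)
  obtain ⟨γ, h0, h⟩ := exists_isMIntegralCurveAt_of_contMDiffAt_boundaryless (t₀ := 0)
    ((hf p).of_le (m := 1) (by simp))
  obtain ⟨ε, hε, h⟩ := isMIntegralCurveAt_iff'.1 h
  refine ⟨ε, hε, γ, h0, ?_⟩
  rwa [Real.ball_eq_Ioo, zero_sub, zero_add] at h

theorem velocity_of_isMIntegralCurveAt {f : Π x : M, TangentSpace (𝓡 2) x} {γ : ℝ → M} {t : ℝ}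
    (h : IsMIntegralCurveAt γ f t) : velocity (I := 𝓡 2) γ t = f (γ t) := by
  rw [velocity, h.hasMFDerivAt.mfderiv]
  exact one_smul ℝ _

/-- A function that is killed by a field is constant on its integral curves. -/
theorem eq_of_isMIntegralCurveOn {f : Π x : M, TangentSpace (𝓡 2) x} {γ : ℝ → M} {a b : ℝ}
    (h : IsMIntegralCurveOn γ f (Set.Ioo a b)) {F : M → ℝ} (hF : ∀ x, SmoothAt F x)
    (hFf : ∀ x, mvfderiv (𝓡 2) F x (f x) = 0) {t t' : ℝ} (ht : t ∈ Set.Ioo a b)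
    (ht' : t' ∈ Set.Ioo a b) : F (γ t) = F (γ t') := by
  have hd : ∀ t ∈ Set.Ioo a b, HasDerivAt (F ∘ γ) 0 t := fun t ht ↦ by
    have := hasDerivAt_comp_of_hasMFDerivAt ((hF (γ t)).mdifferentiableAt (by simp))
      ((h t ht).hasMFDerivAt (isOpen_Ioo.mem_nhds ht))
    rwa [hFf] at this
  exact isOpen_Ioo.is_const_of_deriv_eq_zero isPreconnected_Ioo
    (fun t ht ↦ (hd t ht).differentiableAt.differentiableWithinAt)
    (fun t ht ↦ (hd t ht).deriv) ht ht'

end Curve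

end RiemSurface

namespace RiemSurface

/-! ### The connection form of the gradient frame and the equation for the curvature. -/

section CircularFrame

variable {M : Type*} [TopologicalSpace M] [ChartedSpace (EuclideanSpace ℝ (Fin 2)) M]
  [IsManifold (𝓡 2) ∞ M] [RiemannianBundle (fun x : M ↦ TangentSpace (𝓡 2) x)]
  [IsContMDiffRiemannianBundle (𝓡 2) ∞ (EuclideanSpace ℝ (Fin 2))
      (fun x : M ↦ TangentSpace (𝓡 2) x)]

/-- The frame `(e, f)` has `e` in the direction of the gradient of the Gaussian curvature `K`, its
connection form vanishes on `e`, and on `f` it is `3 dK(e) / (8 (c - K))`, a function that is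
constant on the level curves of `K`. -/
structure CircularFrame (K : M → ℝ) (c : ℝ) (e f : Π x : M, TangentSpace (𝓡 2) x) : Prop where
  frame : OrthonormalFrameOn Set.univ e f
  smooth : ∀ x, SmoothAt K x
  curvature : ∀ x, K x = gaussianCurvature x
  pos : ∀ x, 0 < c - K x
  deriv_right : ∀ x, mvfderiv (𝓡 2) K x (f x) = 0
  deriv_deriv : ∀ x, mvfderiv (𝓡 2) (fun y ↦ mvfderiv (𝓡 2) K y (e y)) x (f x) = 0
  connForm_left : ∀ x, connForm e f x (e x) = 0
  connForm_right : ∀ x, connForm e f x (f x) = 3 * mvfderiv (𝓡 2) K x (e x) / (8 * (c - K x))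

/-- The normalized gradient and a smooth unit field tangent to the level curves. -/
theorem orthonormalFrameOn_mgradient {K : M → ℝ} (hK : ∀ p, K p = gaussianCurvature p)
    (hgrad : ∀ p, mgradient (I := 𝓡 2) K p ≠ 0) {X₁ X₂ : Π p : M, TangentSpace (𝓡 2) p}
    (hX₁ : ∀ p, X₁ p = ‖mgradient (I := 𝓡 2) K p‖⁻¹ • mgradient K p)
    (hX₂ : ∀ x, SmoothFieldAt X₂ x) (h1 : ∀ p, inner ℝ (X₁ p) (X₁ p) = (1 : ℝ))
    (h12 : ∀ p, inner ℝ (X₁ p) (X₂ p) = (0 : ℝ)) (h2 : ∀ p, inner ℝ (X₂ p) (X₂ p) = (1 : ℝ)) :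
    (∀ x, SmoothAt K x) ∧ OrthonormalFrameOn Set.univ X₁ X₂ := by
  have hne (p) : X₁ p ≠ 0 := fun h ↦ by simpa [h] using h1 p
  have hKs (x) : SmoothAt K x := by
    -- X₁ cannot be used yet: its smoothness depends on that of K. An auxiliary local frame is built
    -- from the smooth field X₂, and in it K is a polynomial in connection coefficients and their
    -- derivatives.
    obtain ⟨U, e, hxU, hU⟩ := exists_orthonormalFrameOn hX₂ h2 (hne x) (h12 x)
    rw [show K = gaussianCurvature from funext hK]
    exact hU.contMDiffAt_gaussianCurvature hxU
  refine ⟨hKs, isOpen_univ, fun x _ ↦ ?_, fun x _ ↦ hX₂ x, fun x _ ↦ h1 x, fun x _ ↦ h12 x,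
    fun x _ ↦ h2 x⟩
  obtain ⟨U, e, hxU, hU⟩ := exists_orthonormalFrameOn hX₂ h2 (hne x) (h12 x)
  have hg : SmoothFieldAt (mgradient (I := 𝓡 2) K) x := by
    refine hU.contMDiffAt_of_inner hxU ?_ ?_
    · simp only [inner_mgradient]
      exact contMDiffAt_mvfderiv_apply (hKs x) (hU.smooth_left x hxU)
    · simp only [inner_mgradient]
      exact contMDiffAt_mvfderiv_apply (hKs x) (hX₂ x)
  rw [show X₁ = fun p ↦ ‖mgradient (I := 𝓡 2) K p‖⁻¹ • mgradient K p from funext hX₁]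
  exact contMDiffAt_normalize hg (hgrad x)

theorem mvfderiv_div_apply {x : M} {F G : M → ℝ} (hF : SmoothAt F x) (hG : SmoothAt G x)
    (h0 : G x ≠ 0) (v : TangentSpace (𝓡 2) x) :
    mvfderiv (𝓡 2) (fun y ↦ F y / G y) x v
      = (mvfderiv (𝓡 2) F x v * G x - F x * mvfderiv (𝓡 2) G x v) / G x ^ 2 := by
  have hq : SmoothAt (fun y ↦ F y / G y) x := hF.div₀ hG h0
  have h := mvfderiv_mul_apply hq hG v
  have h' : (fun y ↦ F y / G y * G y) =ᶠ[𝓝 x] F := by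
    filter_upwards [hG.continuousAt.eventually_ne h0] with y hy using div_mul_cancel₀ _ hy
  -- The quotient rule is obtained by differentiating (F / G) · G = F.
  rw [mvfderiv_congr h'] at h
  rw [h]
  field_simp
  ring

theorem mvfderiv_const_sub_apply {x : M} (a : ℝ) {F : M → ℝ} (hF : SmoothAt F x)
    (v : TangentSpace (𝓡 2) x) :
    mvfderiv (𝓡 2) (fun y ↦ a - F y) x v = -mvfderiv (𝓡 2) F x v := by
  have hc : SmoothAt (fun _ : M ↦ a) x := contMDiffAt_const
  rw [mvfderiv_sub_apply hc hF,
    mvfderiv_eq_zero_of_eventually_const (a := a) (.of_forall fun _ ↦ rfl)]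
  simp

/-- The hypothesis on level curves is applied only to integral curves of X₂, and is used twice: the
value of the curvature gives ω(X₂), and its constancy gives X₂X₁K = 0, hence ω(X₁) = 0. -/
theorem circularFrame_of_isCircle (o : SurfaceOrientation M) (c : ℝ) {K : M → ℝ}
    (hK : ∀ p, K p = gaussianCurvature p)
    (hgrad : ∀ p, mgradient (I := 𝓡 2) K p ≠ 0) (hc : ∀ p, 0 < c - K p)
    {X₁ X₂ : Π p : M, TangentSpace (𝓡 2) p}
    (hX₁ : ∀ p, X₁ p = ‖mgradient (I := 𝓡 2) K p‖⁻¹ • mgradient K p)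
    (hX₂ : ∀ x, SmoothFieldAt X₂ x) (hframe : ∀ p, o.IsPositiveOrthonormal (X₁ p) (X₂ p))
    (hcircle : ∀ (γ : ℝ → M) (a b : ℝ), IsLevelCurve K γ a b →
      (∀ t ∈ Set.Ioo a b, o.IsPositive (X₁ (γ t)) (velocity γ t)) →
      ∃ κ : ℝ, IsCircle o γ a b κ ∧ ∀ t ∈ Set.Ioo a b,
        κ = 3 * ‖mgradient (I := 𝓡 2) K (γ t)‖ / (8 * (c - K (γ t)))) :
    CircularFrame K c X₁ X₂ := by
  obtain ⟨hKs, hF⟩ := orthonormalFrameOn_mgradient hK hgrad hX₁ hX₂ (fun p ↦ (hframe p).1)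
    (fun p ↦ (hframe p).2.1) (fun p ↦ (hframe p).2.2.1)
  have hpos (p) : 0 < ‖mgradient (I := 𝓡 2) K p‖ := norm_pos_iff.2 (hgrad p)
  have hgr (p) : mgradient (I := 𝓡 2) K p = ‖mgradient (I := 𝓡 2) K p‖ • X₁ p := by
    rw [hX₁, smul_inv_smul₀ (hpos p).ne']
  have hd1 (p) : mvfderiv (𝓡 2) K p (X₁ p) = ‖mgradient (I := 𝓡 2) K p‖ := by
    rw [← inner_mgradient, hgr, inner_smul_left, (hframe p).1, ← hgr]
    simp
  have hd2 (p) : mvfderiv (𝓡 2) K p (X₂ p) = 0 := by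
    rw [← inner_mgradient, hgr, inner_smul_left, (hframe p).2.1, mul_zero]
  have hs1 (p) : SmoothAt (fun y ↦ mvfderiv (𝓡 2) K y (X₁ y)) p :=
    contMDiffAt_mvfderiv_apply (hKs p) (hF.smooth_left p trivial)
  have hsc (p) : SmoothAt (fun y ↦ c - K y) p :=
    (contMDiffAt_const : SmoothAt (fun _ : M ↦ c) p).sub (hKs p)
  have hsq (p) : SmoothAt (fun y ↦ mvfderiv (𝓡 2) K y (X₁ y) / (c - K y)) p :=
    (hs1 p).div₀ (hsc p) (hc p).ne'
  have key (p) : mvfderiv (𝓡 2) (fun y ↦ mvfderiv (𝓡 2) K y (X₁ y) / (c - K y)) p (X₂ p) = 0 ∧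
      leviCivita (𝓡 2) M X₂ p (X₂ p)
        = -(3 * mvfderiv (𝓡 2) K p (X₁ p) / (8 * (c - K p))) • X₁ p := by
    obtain ⟨ε, hε, γ, h0, hγ⟩ := exists_isMIntegralCurveOn_Ioo hX₂ p
    have hγt (t) (ht : t ∈ Set.Ioo (-ε) ε) : IsMIntegralCurveAt γ X₂ t :=
      hγ.isMIntegralCurveAt (isOpen_Ioo.mem_nhds ht)
    have hvel (t) (ht : t ∈ Set.Ioo (-ε) ε) : velocity (I := 𝓡 2) γ t = X₂ (γ t) :=
      velocity_of_isMIntegralCurveAt (hγt t ht)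
    obtain ⟨κ, ⟨-, hκ⟩, hκ'⟩ := hcircle γ (-ε) ε
      ⟨(IsMIntegralCurveOn.contMDiffOn isOpen_Ioo hX₂ hγ).of_le ENat.LEInfty.out,
        fun t ht ↦ by rw [hvel t ht]; exact (hframe _).2.2.1,
        fun t ht t' ht' ↦ eq_of_isMIntegralCurveOn hγ hKs hd2 ht ht'⟩
      (fun t ht ↦ by rw [hvel t ht]; exact (hframe _).2.2.2)
    have h0m : (0 : ℝ) ∈ Set.Ioo (-ε) ε := ⟨by linarith, hε⟩
    obtain ⟨N, hN, hacc⟩ := hκ 0 h0m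
    -- The velocity is X₂ and (X₁, X₂) is positive, so the normal N is -X₁.
    rw [hvel 0 h0m] at hN
    rw [acceleration_eq_leviCivita (hF.mdiffAt_right trivial) (hγt 0 h0m),
      (hframe _).right_unique hN] at hacc
    subst h0
    refine ⟨?_, ?_⟩
    · have h1 := hasDerivAt_comp_of_hasMFDerivAt ((hsq (γ 0)).mdifferentiableAt (by simp))
        (hγt 0 h0m).hasMFDerivAt
      -- Solving κ = 3 X₁K / (8(c - K)) for the quotient gives the constant 8κ/3.
      refine h1.unique ((hasDerivAt_const (0 : ℝ) (κ * 8 / 3)).congr_of_eventuallyEq ?_)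
      filter_upwards [isOpen_Ioo.mem_nhds h0m] with t ht
      have := (hc (γ t)).ne'
      rw [Function.comp_apply, hκ' t ht, hd1]
      field_simp
    · rw [hacc, hκ' 0 h0m, hd1, smul_neg, neg_smul]
  have hdd (p) : mvfderiv (𝓡 2) (fun y ↦ mvfderiv (𝓡 2) K y (X₁ y)) p (X₂ p) = 0 := by
    have h := (key p).1
    have h0 := (hc p).ne'
    rw [mvfderiv_div_apply (hs1 p) (hsc p) h0, mvfderiv_const_sub_apply c (hKs p), hd2, neg_zero,
      mul_zero, sub_zero] at h
    simpa [h0] using h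
  refine ⟨hF, hKs, hK, hc, hd2, hdd, fun p ↦ ?_, fun p ↦ ?_⟩
  -- Both iterated derivatives of K vanish, so [X₁, X₂]K = 0, that is -ω(X₁) X₁K = 0, and X₁K = |∇K|
  -- is nonzero.
  · have h := mvfderiv_apply_mlieBracket (hKs p) (hF.smooth_left p trivial) (hX₂ p)
    rw [hdd, mvfderiv_eq_zero_of_eventually_const (a := 0) (.of_forall hd2),
      hF.mlieBracket_eq trivial] at h
    have h' : -connForm X₁ X₂ p (X₁ p) * mvfderiv (𝓡 2) K p (X₁ p) = 0 := by
      simpa [hd2] using h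
    have := (hpos p).ne'
    rw [hd1] at h'
    simpa [this] using h'
  · have h := hF.leviCivita_right trivial (X₂ p)
    rw [(key p).2] at h
    have h' := congrArg (fun v ↦ (inner ℝ v (X₁ p) : ℝ)) h
    simp only [inner_smul_left, (hframe p).1] at h'
    simpa using h'.symm

namespace CircularFrame

variable {K : M → ℝ} {c : ℝ} {e f : Π x : M, TangentSpace (𝓡 2) x}

theorem smooth_deriv (h : CircularFrame K c e f) (x : M) :
    SmoothAt (fun y ↦ mvfderiv (𝓡 2) K y (e y)) x :=
  contMDiffAt_mvfderiv_apply (h.smooth x) (h.frame.smooth_left x trivial)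

theorem smooth_const_sub (h : CircularFrame K c e f) (x : M) : SmoothAt (fun y ↦ c - K y) x :=
  (contMDiffAt_const : SmoothAt (fun _ : M ↦ c) x).sub (h.smooth x)

/-- The second derivative of the curvature in the direction of its gradient. -/
theorem deriv_deriv_left (h : CircularFrame K c e f) (x : M) :
    24 * (c - K x) * mvfderiv (𝓡 2) (fun y ↦ mvfderiv (𝓡 2) K y (e y)) x (e x)
      + 33 * mvfderiv (𝓡 2) K x (e x) ^ 2 + 64 * K x * (c - K x) ^ 2 = 0 := by
  have hK := (h.curvature x).trans (h.frame.gaussianCurvature_eq (Set.mem_univ x))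
  have h8 : SmoothAt (fun y ↦ 8 * (c - K y)) x :=
    smoothAt_mul contMDiffAt_const (h.smooth_const_sub x)
  have h3 : SmoothAt (fun y ↦ 3 * mvfderiv (𝓡 2) K y (e y)) x :=
    smoothAt_mul contMDiffAt_const (h.smooth_deriv x)
  have h0 := (h.pos x).ne'
  have hcst (a : ℝ) : mvfderiv (𝓡 2) (fun _ : M ↦ a) x = 0 :=
    mvfderiv_eq_zero_of_eventually_const (a := a) (.of_forall fun _ ↦ rfl)
  rw [frameCurvature, mvfderiv_eq_zero_of_eventually_const (a := 0) (.of_forall h.connForm_left),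
    show (fun y ↦ connForm e f y (f y)) = _ from funext h.connForm_right,
    mvfderiv_div_apply h3 h8 (by simpa using h0),
    mvfderiv_mul_apply contMDiffAt_const (h.smooth_deriv x),
    mvfderiv_mul_apply contMDiffAt_const (h.smooth_const_sub x),
    mvfderiv_const_sub_apply c (h.smooth x), hcst, hcst, h.connForm_left, h.connForm_right] at hK
  simp only [zero_apply] at hK
  field_simp at hK
  -- `hK` is K = -eκ - κ² multiplied out; the coefficient 33 is 24 + 9, from the derivative of 1/(c
  -- - K) and from κ².
  linear_combination hK

end CircularFrame

end CircularFrame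

end RiemSurface

namespace RiemSurface

/-! ### Coordinates adapted to the frame. -/

section AdaptedCoordinates

variable {M : Type*} [TopologicalSpace M] [ChartedSpace (EuclideanSpace ℝ (Fin 2)) M]
  [IsManifold (𝓡 2) ∞ M]

theorem mvfderiv_rpow_apply {x : M} {F : M → ℝ} (hF : SmoothAt F x) (h0 : 0 < F x) (r : ℝ)
    (v : TangentSpace (𝓡 2) x) :
    mvfderiv (𝓡 2) (fun y ↦ F y ^ r) x v = r * F x ^ (r - 1) * mvfderiv (𝓡 2) F x v := by
  have hd := Real.hasDerivAt_rpow_const (p := r) (Or.inl h0.ne')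
  have h := mvfderiv_comp_apply (I := 𝓘(ℝ, ℝ)) (I' := 𝓡 2) (g := fun t : ℝ ↦ t ^ r) x
    hd.differentiableAt.mdifferentiableAt (hF.mdifferentiableAt (by simp)) v
  rw [mvfderiv_eq_fderiv, hd.hasFDerivAt.fderiv] at h
  refine h.trans ?_
  change (mvfderiv (𝓡 2) F x v) • (r * F x ^ (r - 1)) = _
  rw [smul_eq_mul, mul_comm]

theorem smoothAt_rpow {x : M} {F : M → ℝ} (hF : SmoothAt F x) (h0 : 0 < F x) (r : ℝ) :
    SmoothAt (fun y ↦ F y ^ r) x :=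
  (Real.contDiffAt_rpow_const_of_ne h0.ne').contMDiffAt.comp x hF

/-- The velocity of the image of a curve under a differentiable map. -/
theorem hasMFDerivAt_comp_of_hasDerivAt {X : ℝ × ℝ → M} {γ : ℝ → ℝ × ℝ} {t : ℝ} {w : ℝ × ℝ}
    (hX : MDifferentiableAt 𝓘(ℝ, ℝ × ℝ) (𝓡 2) X (γ t)) (hγ : HasDerivAt γ w t) :
    HasMFDerivAt 𝓘(ℝ, ℝ) (𝓡 2) (X ∘ γ) t
      ((1 : ℝ →L[ℝ] ℝ).smulRight (mfderiv 𝓘(ℝ, ℝ × ℝ) (𝓡 2) X (γ t) w)) := by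
  have h := hX.hasMFDerivAt.comp t hγ.hasFDerivAt.hasMFDerivAt
  let D : ℝ × ℝ →L[ℝ] TangentSpace (𝓡 2) (X (γ t)) := mfderiv 𝓘(ℝ, ℝ × ℝ) (𝓡 2) X (γ t)
  have h2 : (1 : ℝ →L[ℝ] ℝ).smulRight (D w)
      = D.comp (ContinuousLinearMap.toSpanSingleton ℝ w) := by
    ext
    simp
  change HasMFDerivAt 𝓘(ℝ, ℝ) (𝓡 2) (X ∘ γ) t ((1 : ℝ →L[ℝ] ℝ).smulRight (D w))
  rw [h2]
  exact h

/-- The differential of a coordinate function in a parametrization. -/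
theorem mvfderiv_mfderiv_apply {X : ℝ × ℝ → M} {q : ℝ × ℝ} {u : M → ℝ}
    (hX : MDifferentiableAt 𝓘(ℝ, ℝ × ℝ) (𝓡 2) X q) (hu : SmoothAt u (X q))
    {L : ℝ × ℝ →L[ℝ] ℝ} (h : u ∘ X =ᶠ[𝓝 q] L) (w : ℝ × ℝ) :
    mvfderiv (𝓡 2) u (X q) (mfderiv 𝓘(ℝ, ℝ × ℝ) (𝓡 2) X q w) = L w := by
  have h1 := mvfderiv_comp_apply (I := 𝓡 2) (I' := 𝓘(ℝ, ℝ × ℝ)) (g := u) q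
    (hu.mdifferentiableAt (by simp)) hX w
  rw [mvfderiv_eq_fderiv, h.fderiv_eq, L.fderiv] at h1
  exact h1.symm

variable [RiemannianBundle (fun x : M ↦ TangentSpace (𝓡 2) x)]
  [IsContMDiffRiemannianBundle (𝓡 2) ∞ (EuclideanSpace ℝ (Fin 2))
      (fun x : M ↦ TangentSpace (𝓡 2) x)]

namespace CircularFrame

variable {K : M → ℝ} {c : ℝ} {e f : Π x : M, TangentSpace (𝓡 2) x}

/-- Functions whose differentials are, up to the connection form, dual to the frame. -/
theorem exists_adapted_functions (h : CircularFrame K c e f) (p : M) :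
    ∃ U, IsOpen U ∧ p ∈ U ∧ ∃ u s : M → ℝ, (∀ x ∈ U, SmoothAt u x) ∧ (∀ x ∈ U, SmoothAt s x) ∧
      u p = 0 ∧ s p = 0 ∧ ∀ x ∈ U, mvfderiv (𝓡 2) u x (e x) = 1 ∧ mvfderiv (𝓡 2) u x (f x) = 0 ∧
        mvfderiv (𝓡 2) s x (e x) = 3 * mvfderiv (𝓡 2) K x (e x) / (8 * (c - K x)) * s x ∧
        mvfderiv (𝓡 2) s x (f x) = 1 := by
  have hcst (a : ℝ) (x : M) : mvfderiv (𝓡 2) (fun _ : M ↦ a) x = 0 :=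
    mvfderiv_eq_zero_of_eventually_const (a := a) (.of_forall fun _ ↦ rfl)
  -- An integrating factor: the exponent 3/8 is the one for which eB = -κB, which removes the term κ
  -- s from the equation for B s.
  set B : M → ℝ := fun x ↦ (c - K x) ^ (3 / 8 : ℝ)
  have hB (x) : SmoothAt B x := smoothAt_rpow (h.smooth_const_sub x) (h.pos x) _
  have hB0 (x) : B x ≠ 0 := (Real.rpow_pos_of_pos (h.pos x) _).ne'
  have hBv (x) (v : TangentSpace (𝓡 2) x) :
      mvfderiv (𝓡 2) B x v = -(3 * mvfderiv (𝓡 2) K x v / (8 * (c - K x))) * B x := by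
    rw [mvfderiv_rpow_apply (h.smooth_const_sub x) (h.pos x), Real.rpow_sub_one (h.pos x).ne',
      mvfderiv_const_sub_apply c (h.smooth x)]
    have := (h.pos x).ne'
    simp only [B]
    field_simp
  -- Integrability of (1, 0) is exactly ω(e) = 0.
  obtain ⟨U₁, -, hU₁, hp₁, u, hu, hup, hdu⟩ := h.frame.exists_primitive (F := fun _ ↦ 1)
    (G := fun _ ↦ 0) (fun _ _ ↦ contMDiffAt_const) (fun _ _ ↦ contMDiffAt_const)
    (fun x _ ↦ by rw [hcst, hcst, h.connForm_left]; simp) (Set.mem_univ p)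
  -- Integrability of (0, B) is eB = -ω(f)B, true because ω(f) = κ.
  obtain ⟨U₂, -, hU₂, hp₂, v, hv, hvp, hdv⟩ := h.frame.exists_primitive (F := fun _ ↦ 0)
    (G := B) (fun _ _ ↦ contMDiffAt_const) (fun x _ ↦ hB x)
    (fun x _ ↦ by rw [hcst, hBv, h.connForm_left, h.connForm_right]; simp) (Set.mem_univ p)
  refine ⟨U₁ ∩ U₂, hU₁.inter hU₂, ⟨hp₁, hp₂⟩, u, fun x ↦ v x / B x, fun x hx ↦ hu x hx.1,
    fun x hx ↦ (hv x hx.2).div₀ (hB x) (hB0 x), hup, by simp [hvp],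
    fun x hx ↦ ⟨(hdu x hx.1).1, (hdu x hx.1).2, ?_, ?_⟩⟩
  · rw [mvfderiv_div_apply (hv x hx.2) (hB x) (hB0 x), (hdv x hx.2).1, hBv]
    have := hB0 x
    field_simp
    ring
  · rw [mvfderiv_div_apply (hv x hx.2) (hB x) (hB0 x), (hdv x hx.2).2, hBv, h.deriv_right]
    have := hB0 x
    field_simp
    simp

/-- Coordinates in which the frame is `(X_u + κ s X_s, X_s)`, where `κ` is the curvature of the
level curves. -/
theorem exists_adapted_coordinates (h : CircularFrame K c e f) (p : M) :
    ∃ (ε : ℝ) (X : OpenPartialHomeomorph (ℝ × ℝ) M), 0 < ε ∧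
      X.source = Set.Ioo (-ε) ε ×ˢ Set.Ioo (-ε) ε ∧
      ContMDiffOn 𝓘(ℝ, ℝ × ℝ) (𝓡 2) ∞ X X.source ∧
      ContMDiffOn (𝓡 2) 𝓘(ℝ, ℝ × ℝ) ∞ X.symm X.target ∧ X (0, 0) = p ∧
      ∀ a b : ℝ, (a, b) ∈ X.source →
        partialU X a b = e (X (a, b))
          - (3 * mvfderiv (𝓡 2) K (X (a, b)) (e (X (a, b))) / (8 * (c - K (X (a, b)))) * b)
            • f (X (a, b)) ∧
        partialS X a b = f (X (a, b)) := by
  obtain ⟨U, hU, hp, u, s, hu, hs, hup, hsp, hd⟩ := h.exists_adapted_functions p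
  have hinj : ∀ x ∈ U, ∀ v : TangentSpace (𝓡 2) x, mvfderiv (𝓡 2) u x v = 0 →
      mvfderiv (𝓡 2) s x v = 0 → v = 0 := by
    intro x hx v hv hv'
    obtain ⟨h1, h2, h3, h4⟩ := hd x hx
    rw [h.frame.mvfderiv_apply_expand (Set.mem_univ x), h1, h2] at hv
    rw [h.frame.mvfderiv_apply_expand (Set.mem_univ x), h4] at hv'
    have hve : (inner ℝ v (e x) : ℝ) = 0 := by simpa using hv
    have hvf : (inner ℝ v (f x) : ℝ) = 0 := by simpa [hve] using hv'
    rw [h.frame.expand (Set.mem_univ x) v, hve, hvf]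
    simp
  obtain ⟨ε, X, hε, hsrc, htgt, hX, hX', hX0, hus⟩ :=
    exists_coordinates hU hp hu hs hup hsp hinj
  refine ⟨ε, X, hε, hsrc, hX, hX', hX0, fun a b hq ↦ ?_⟩
  have hxU : X (a, b) ∈ U := htgt (X.map_source hq)
  have hXd : MDifferentiableAt 𝓘(ℝ, ℝ × ℝ) (𝓡 2) X (a, b) :=
    (hX.contMDiffAt (X.open_source.mem_nhds hq)).mdifferentiableAt (by simp)
  have hfst (w : ℝ × ℝ) := mvfderiv_mfderiv_apply (L := ContinuousLinearMap.fst ℝ ℝ ℝ) hXd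
    (hu _ hxU) (by
      filter_upwards [X.open_source.mem_nhds hq] with q hq using (hus q hq).1) w
  have hsnd (w : ℝ × ℝ) := mvfderiv_mfderiv_apply (L := ContinuousLinearMap.snd ℝ ℝ ℝ) hXd
    (hs _ hxU) (by
      filter_upwards [X.open_source.mem_nhds hq] with q hq using (hus q hq).2) w
  obtain ⟨h1, h2, h3, h4⟩ := hd _ hxU
  rw [(hus _ hq).2] at h3
  have h5 : mvfderiv (𝓡 2) u (X (a, b)) (partialU X a b) = 1 := hfst (1, 0)
  have h6 : mvfderiv (𝓡 2) s (X (a, b)) (partialU X a b) = 0 := hsnd (1, 0)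
  have h7 : mvfderiv (𝓡 2) u (X (a, b)) (partialS X a b) = 0 := hfst (0, 1)
  have h8 : mvfderiv (𝓡 2) s (X (a, b)) (partialS X a b) = 1 := hsnd (0, 1)
  constructor
  -- The differentials of u and s separate tangent vectors, so it suffices that both sides agree
  -- under them; the correction -κ s f cancels ds(e) = κ s.
  · refine sub_eq_zero.1 (hinj _ hxU _ ?_ ?_)
    · simp [h1, h2, h5]
    · simp [h3, h4, h6]
  · refine sub_eq_zero.1 (hinj _ hxU _ ?_ ?_)
    · simp [h2, h7]
    · simp [h4, h8]

end CircularFrame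

end AdaptedCoordinates

end RiemSurface

/-! ### The theorem, assembled from the frame and the coordinates. -/

theorem mainTheorem4 {M : Type*} [TopologicalSpace M] [T2Space M] [SecondCountableTopology M]
    [ConnectedSpace M] [ChartedSpace (EuclideanSpace ℝ (Fin 2)) M] [IsManifold (𝓡 2) ∞ M]
    [RiemannianBundle (fun x : M ↦ TangentSpace (𝓡 2) x)]
    [IsContMDiffRiemannianBundle (𝓡 2) ∞ (EuclideanSpace ℝ (Fin 2))
      (fun x : M ↦ TangentSpace (𝓡 2) x)]
    (o : RiemSurface.SurfaceOrientation M) (c : ℝ)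
    (K : M → ℝ) (hK : ∀ p, K p = RiemSurface.gaussianCurvature p)
    (hgrad : ∀ p, RiemSurface.mgradient (I := 𝓡 2) K p ≠ 0) (hc : ∀ p, 0 < c - K p)
    (X₁ X₂ : Π p : M, TangentSpace (𝓡 2) p)
    (hX₁ : ∀ p, X₁ p = ‖RiemSurface.mgradient (I := 𝓡 2) K p‖⁻¹ • RiemSurface.mgradient K p)
    (hX₂ : ContMDiff (𝓡 2) (𝓡 2).tangent ∞ (fun p ↦ (⟨p, X₂ p⟩ : TangentBundle (𝓡 2) M)))
    (hframe : ∀ p, o.IsPositiveOrthonormal (X₁ p) (X₂ p))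
    -- the level curves of `K`, directed so that `(X₁, γ')` is positively oriented, are circles
    -- of curvature `3|∇K| / (8(c - K))`
    (hcircle : ∀ (γ : ℝ → M) (a b : ℝ), RiemSurface.IsLevelCurve K γ a b →
      (∀ t ∈ Set.Ioo a b, o.IsPositive (X₁ (γ t)) (RiemSurface.velocity γ t)) →
      ∃ κ : ℝ, RiemSurface.IsCircle o γ a b κ ∧ ∀ t ∈ Set.Ioo a b,
        κ = 3 * ‖RiemSurface.mgradient (I := 𝓡 2) K (γ t)‖ / (8 * (c - K (γ t)))) :
    (∀ p₀ : M, ∃ (ε : ℝ) (X : OpenPartialHomeomorph (ℝ × ℝ) M) (k : ℝ → ℝ),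
      0 < ε ∧ X.source = Set.Ioo (-ε) ε ×ˢ Set.Ioo (-ε) ε ∧
      ContMDiffOn 𝓘(ℝ, ℝ × ℝ) (𝓡 2) ∞ X X.source ∧
      ContMDiffOn (𝓡 2) 𝓘(ℝ, ℝ × ℝ) ∞ X.symm X.target ∧
      (∀ u ∈ Set.Ioo (-ε) ε, ∀ s ∈ Set.Ioo (-ε) ε,
        o.IsPositive (RiemSurface.partialU X u s) (RiemSurface.partialS X u s)) ∧
      -- the coordinate curves
      IsMIntegralCurveOn (fun u ↦ X (u, 0)) X₁ (Set.Ioo (-ε) ε) ∧ X (0, 0) = p₀ ∧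
      (∀ u ∈ Set.Ioo (-ε) ε, IsMIntegralCurveOn (fun s ↦ X (u, s)) X₂ (Set.Ioo (-ε) ε)) ∧
      -- `K` is a function of `u` alone, again called `k`
      ContDiffOn ℝ ∞ k (Set.Ioo (-ε) ε) ∧
      (∀ u ∈ Set.Ioo (-ε) ε, ∀ s ∈ Set.Ioo (-ε) ε,
        K (X (u, s)) = K (X (u, 0)) ∧ K (X (u, 0)) = k u) ∧
      -- the coefficients of the metric
      (∀ u ∈ Set.Ioo (-ε) ε, ∀ s ∈ Set.Ioo (-ε) ε,
        inner ℝ (RiemSurface.partialU X u s) (RiemSurface.partialU X u s)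
          = 9 / 64 * (deriv k u / (c - k u)) ^ 2 * s ^ 2 + 1 ∧
        inner ℝ (RiemSurface.partialU X u s) (RiemSurface.partialS X u s)
          = -(3 * deriv k u / (8 * (c - k u))) * s ∧
        inner ℝ (RiemSurface.partialS X u s) (RiemSurface.partialS X u s) = (1 : ℝ)) ∧
      -- the differential equation for the curvature
      (∀ u ∈ Set.Ioo (-ε) ε,
        24 * (c - k u) * deriv (deriv k) u + 33 * deriv k u ^ 2 + 64 * k u * (c - k u) ^ 2 = 0) ∧
      -- the frame in the coordinates
      (∀ u ∈ Set.Ioo (-ε) ε, ∀ s ∈ Set.Ioo (-ε) ε,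
        X₁ (X (u, s)) = RiemSurface.partialU X u s
          - (inner ℝ (RiemSurface.partialU X u s) (RiemSurface.partialS X u s) : ℝ)
            • RiemSurface.partialS X u s ∧
        X₂ (X (u, s)) = RiemSurface.partialS X u s)) ∧
    -- the Levi-Civita connection
    (∀ p : M,
      RiemSurface.leviCivita (𝓡 2) M X₁ p (X₁ p) = 0 ∧
      RiemSurface.leviCivita (𝓡 2) M X₂ p (X₁ p) = 0 ∧
      RiemSurface.leviCivita (𝓡 2) M X₂ p (X₂ p)
        = -(3 * mvfderiv (𝓡 2) K p (X₁ p) / (8 * (c - K p))) • X₁ p ∧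
      RiemSurface.leviCivita (𝓡 2) M X₁ p (X₂ p)
        = (3 * mvfderiv (𝓡 2) K p (X₁ p) / (8 * (c - K p))) • X₂ p) ∧
    -- the integral curves of `X₁` are geodesics
    (∀ (γ : ℝ → M) (a b : ℝ), IsMIntegralCurveOn γ X₁ (Set.Ioo a b) →
      RiemSurface.IsGeodesicOn (𝓡 2) γ (Set.Ioo a b)) := by
  have hX₂' : ∀ x, RiemSurface.SmoothFieldAt X₂ x := fun x ↦ hX₂ x
  have h := RiemSurface.circularFrame_of_isCircle o c hK hgrad hc hX₁ hX₂' hframe hcircle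
  have hL1 (p : M) : RiemSurface.leviCivita (𝓡 2) M X₁ p (X₁ p) = 0 := by
    rw [h.frame.leviCivita_left trivial, h.connForm_left, zero_smul]
  refine ⟨fun p₀ ↦ ?_, fun p ↦ ⟨hL1 p, ?_, ?_, ?_⟩, fun γ a b hγ ↦ ⟨?_, fun t ht ↦ ?_⟩⟩
  · obtain ⟨ε, X, hε, hsrc, hX, hX', hX0, hpar⟩ := h.exists_adapted_coordinates p₀
    have h0 : (0 : ℝ) ∈ Set.Ioo (-ε) ε := ⟨by linarith, hε⟩
    have hmem {a b : ℝ} (ha : a ∈ Set.Ioo (-ε) ε) (hb : b ∈ Set.Ioo (-ε) ε) :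
        (a, b) ∈ X.source := by
      rw [hsrc]
      exact ⟨ha, hb⟩
    have hXd {q : ℝ × ℝ} (hq : q ∈ X.source) : MDifferentiableAt 𝓘(ℝ, ℝ × ℝ) (𝓡 2) X q :=
      (hX.contMDiffAt (X.open_source.mem_nhds hq)).mdifferentiableAt (by simp)
    have hcu : ∀ u ∈ Set.Ioo (-ε) ε, HasMFDerivAt 𝓘(ℝ, ℝ) (𝓡 2) (fun u ↦ X (u, 0)) u
        ((1 : ℝ →L[ℝ] ℝ).smulRight (X₁ (X (u, 0)))) := by
      intro u hu
      have h1 := RiemSurface.hasMFDerivAt_comp_of_hasDerivAt (X := X) (γ := fun u ↦ (u, 0))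
        (hXd (hmem hu h0)) ((hasDerivAt_id u).prodMk (hasDerivAt_const u (0 : ℝ)))
      have h2 := (hpar u 0 (hmem hu h0)).1
      -- The correction κ s X₂ vanishes on the axis s = 0, so there X_u is X₁ itself.
      rw [mul_zero, zero_smul, sub_zero] at h2
      rw [← h2]
      exact h1
    have hcs : ∀ u ∈ Set.Ioo (-ε) ε,
        IsMIntegralCurveOn (fun s ↦ X (u, s)) X₂ (Set.Ioo (-ε) ε) := by
      intro u hu s hs
      have h1 := RiemSurface.hasMFDerivAt_comp_of_hasDerivAt (X := X) (γ := fun s ↦ (u, s))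
        (hXd (hmem hu hs)) ((hasDerivAt_const s u).prodMk (hasDerivAt_id s))
      rw [← (hpar u s (hmem hu hs)).2]
      exact h1.hasMFDerivWithinAt
    let k : ℝ → ℝ := fun u ↦ K (X (u, 0))
    let D : M → ℝ := fun x ↦ mvfderiv (𝓡 2) K x (X₁ x)
    have hk : ∀ u ∈ Set.Ioo (-ε) ε, ∀ s ∈ Set.Ioo (-ε) ε, K (X (u, s)) = k u :=
      fun u hu s hs ↦
        RiemSurface.eq_of_isMIntegralCurveOn (hcs u hu) h.smooth h.deriv_right hs h0
    have hk' : ∀ u ∈ Set.Ioo (-ε) ε, HasDerivAt k (D (X (u, 0))) u := fun u hu ↦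
      RiemSurface.hasDerivAt_comp_of_hasMFDerivAt ((h.smooth _).mdifferentiableAt (by simp))
        (hcu u hu)
    -- X₂ annihilates X₁K, so X₁K depends on u alone and equals its value on the axis, the
    -- derivative of k. This is what lets κ be written through k at every (u, s).
    have hD : ∀ u ∈ Set.Ioo (-ε) ε, ∀ s ∈ Set.Ioo (-ε) ε, D (X (u, s)) = deriv k u :=
      fun u hu s hs ↦ (RiemSurface.eq_of_isMIntegralCurveOn (hcs u hu) h.smooth_deriv
        h.deriv_deriv hs h0).trans (hk' u hu).deriv.symm
    have hk'' : ∀ u ∈ Set.Ioo (-ε) ε,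
        deriv (deriv k) u = mvfderiv (𝓡 2) D (X (u, 0)) (X₁ (X (u, 0))) := by
      intro u hu
      have h1 : HasDerivAt (D ∘ fun u ↦ X (u, 0)) _ u :=
        RiemSurface.hasDerivAt_comp_of_hasMFDerivAt
          ((h.smooth_deriv _).mdifferentiableAt (by simp)) (hcu u hu)
      refine (h1.congr_of_eventuallyEq ?_).deriv
      filter_upwards [isOpen_Ioo.mem_nhds hu] with v hv using (hk' v hv).deriv
    have hpar' : ∀ u ∈ Set.Ioo (-ε) ε, ∀ s ∈ Set.Ioo (-ε) ε,
        RiemSurface.partialU X u s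
          = X₁ (X (u, s)) - (3 * deriv k u / (8 * (c - k u)) * s) • X₂ (X (u, s)) ∧
        RiemSurface.partialS X u s = X₂ (X (u, s)) := by
      intro u hu s hs
      have h1 := hpar u s (hmem hu hs)
      rw [hk u hu s hs, show mvfderiv (𝓡 2) K (X (u, s)) (X₁ (X (u, s))) = deriv k u from
        hD u hu s hs] at h1
      exact h1
    have hg12 : ∀ u ∈ Set.Ioo (-ε) ε, ∀ s ∈ Set.Ioo (-ε) ε,
        inner ℝ (RiemSurface.partialU X u s) (RiemSurface.partialS X u s)
          = -(3 * deriv k u / (8 * (c - k u))) * s := by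
      intro u hu s hs
      obtain ⟨h1, h2⟩ := hpar' u hu s hs
      obtain ⟨i1, i12, i2, -⟩ := hframe (X (u, s))
      rw [h1, h2, inner_sub_left, inner_smul_left, i12, i2]
      simp
    refine ⟨ε, X, k, hε, hsrc, hX, hX', fun u hu s hs ↦ ?_,
      fun u hu ↦ (hcu u hu).hasMFDerivWithinAt, hX0, hcs, ?_,
      fun u hu s hs ↦ ⟨hk u hu s hs, rfl⟩, fun u hu s hs ↦ ⟨?_, hg12 u hu s hs, ?_⟩,
      fun u hu ↦ ?_, fun u hu s hs ↦ ⟨?_, (hpar' u hu s hs).2.symm⟩⟩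
    · obtain ⟨h1, h2⟩ := hpar' u hu s hs
      -- The change from (X₁, X₂) to (X_u, X_s) is unipotent, with determinant 1.
      have h3 := ((hframe (X (u, s))).2.2.2.iff_det_pos 1
        (-(3 * deriv k u / (8 * (c - k u)) * s)) 0 1).2 (by norm_num)
      rw [h1, h2]
      simpa only [one_smul, zero_smul, zero_add, neg_smul, ← sub_eq_add_neg] using h3
    · have h1 : ContMDiffOn 𝓘(ℝ, ℝ) 𝓘(ℝ, ℝ) ∞ k (Set.Ioo (-ε) ε) := by
        intro u hu
        have hi : ContMDiffAt 𝓘(ℝ, ℝ) 𝓘(ℝ, ℝ × ℝ) ∞ (fun u : ℝ ↦ (u, (0 : ℝ))) u :=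
          (contDiffAt_id.prodMk contDiffAt_const).contMDiffAt
        exact ((h.smooth _).comp u ((hX.contMDiffAt
          (X.open_source.mem_nhds (hmem hu h0))).comp u hi)).contMDiffWithinAt
      exact h1.contDiffOn
    · obtain ⟨h1, -⟩ := hpar' u hu s hs
      obtain ⟨i1, i12, i2, -⟩ := hframe (X (u, s))
      have hk0 : c - k u ≠ 0 := (hc _).ne'
      have i21 : inner ℝ (X₂ (X (u, s))) (X₁ (X (u, s))) = (0 : ℝ) := by
        rw [real_inner_comm, i12]
      rw [h1, inner_sub_left, inner_sub_right, inner_sub_right]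
      simp only [inner_smul_left, inner_smul_right, i1, i12, i2, i21, conj_trivial]
      field_simp
      ring
    · rw [(hpar' u hu s hs).2]
      exact (hframe _).2.2.1
    · have h1 := h.deriv_deriv_left (X (u, 0))
      rw [hk'' u hu, ← hD u hu 0 h0]
      exact h1
    · rw [hg12 u hu s hs, (hpar' u hu s hs).1, (hpar' u hu s hs).2, neg_mul, neg_smul,
        sub_neg_eq_add, sub_add_cancel]
  · rw [h.frame.leviCivita_right trivial, h.connForm_left, neg_zero, zero_smul]
  · rw [h.frame.leviCivita_right trivial, h.connForm_right]
  · rw [h.frame.leviCivita_left trivial, h.connForm_right]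
  · exact RiemSurface.IsMIntegralCurveOn.contMDiffOn isOpen_Ioo
      (fun x ↦ h.frame.smooth_left x trivial) hγ
  · rw [RiemSurface.acceleration_eq_leviCivita (h.frame.mdiffAt_left trivial)
      (hγ.isMIntegralCurveAt (isOpen_Ioo.mem_nhds ht)), hL1]
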